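/- **Setting.** A game $\mathcal G$ has a finite set of players $\mathrm{Agt}$, finite pairwise disjoint sets $S_i$ ($i\in\mathrm{Agt}$) of states with union $S$, an initial state, a set of actions $\mathrm{Act}_i$ for each player, a transition function sending a state $s\in S_i$ and an action $a\in\mathrm{Act}_i$ to a state $\delta(s,a)$, and for each player $i$ an objective $\phi_i$, which is a set of runs. A run is an infinite sequence $s_1a_1s_2a_2\dots$ with $s_{k+1}=\delta(s_k,a_k)$; a history is a finite prefix of a run that ends in a state. A strategy of player $i$ maps each history ending in $S_i$ to an action in $\mathrm{Act}_i$; $\Sigma_i$ is the set of these strategies. For a profile $\sigma_P$ of strategies of the players in $P$, $\sigma_P\models\phi$ means that all runs from the initial state that are compatible with $\sigma_P$ belong to $\phi$. A strategy $\sigma_i$ is dominated by $\sigma_i'$ if, for all $\sigma_{-i}$, $(\sigma_i,\sigma_{-i})\models\phi_i$ implies $(\sigma_i',\sigma_{-i})\models\phi_i$, and for some $\sigma_{-i}$ the second holds and the first does not; it is admissible if no strategy dominates it. An objective is a Muller condition if membership of a run depends only on the set of states it visits infinitely often, and is $\omega$-regular if it is recognized by a finite deterministic Muller automaton reading the run;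 Muller conditions are $\omega$-regular. **Rules.** Each rule asks for a strategy profile $\sigma=(\sigma_i)_{i\in\mathrm{Agt}}$ such that: - $\mathsf{Coop}$: $\sigma\models\bigwedge_i\phi_i$. - $\mathsf{Win}$: $\sigma_i\models\phi_i$ for every $i$. - $\mathsf{AG}^\wedge$: $\sigma\models\bigwedge_i\phi_i$ and, for every $i$, $\sigma_i\models(\bigwedge_{j\ne i}\phi_j)\Rightarrow\phi_i$. - $\mathsf{AG}^\vee$: $\sigma\models\bigwedge_i\phi_i$ and, for every $i$, $\sigma_i\models(\bigvee_{j\ne i}\phi_j)\Rightarrow\phi_i$. - $\mathsf{AA}$: every $\sigma_i$ is admissible, and for every $i$ and all profiles $\sigma'_{-i}$ of admissible strategies of the other players, $(\sigma_i,\sigma'_{-i})\models\phi_i$. For the rational synthesis rules, fix a player, called player $1$ (the system). For $\gamma\in\{\mathsf{NE},\mathsf{SPE},\mathsf{Dom}\}$ and a strategy $\sigma_1$, let $\Sigma^\gamma_{\sigma_1}$ be the set of profiles $\sigma_{-1}$ of the other players such that, respectively: no player $j\neq1$ can turn a loss under $(\sigma_1,\sigma_{-1})$ into a win by changing only her own strategy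 ($\mathsf{NE}$); after every history $h$, if all players continue with $(\sigma_1,\sigma_{-1})$, no player $j\ne1$ can turn a loss into a win by changing only her own strategy, where the objectives are evaluated on the whole run, including $h$ ($\mathsf{SPE}$); each $\sigma_j$, $j\ne 1$, satisfies: for all $\sigma_j'$ and all strategies of the players other than $1$ and $j$, with player $1$ playing $\sigma_1$, if $j$ wins with $\sigma'_j$ then $j$ wins with $\sigma_j$ ($\mathsf{Dom}$). Then - $\mathsf{RS}^\exists(\gamma)$: there are $\sigma_1$ and $\sigma_{-1}\in\Sigma^\gamma_{\sigma_1}$ with $(\sigma_1,\sigma_{-1})\models\phi_1$. - $\mathsf{RS}^\forall(\gamma)$: there is $\sigma_1$ with $\Sigma^\gamma_{\sigma_1}\neq\emptyset$ and $(\sigma_1,\sigma_{-1})\models\phi_1$ for all $\sigma_{-1}\in\Sigma^\gamma_{\sigma_1}$. A rule $\mathsf A$ implies a rule $\mathsf B$ if $\mathsf B$ has a solution in every game (of the class considered) in which $\mathsf A$ has one. **Theorem.** 1. For all games (with arbitrary objectives): $\mathsf{Win}$ implies $\mathsf{AA}$, $\mathsf{AG}^\vee$, $\mathsf{AG}^\wedge$,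 and $\mathsf{RS}^\exists(\gamma)$ and $\mathsf{RS}^\forall(\gamma)$ for $\gamma\in\{\mathsf{NE},\mathsf{Dom}\}$; $\mathsf{AG}^\vee$ implies $\mathsf{AG}^\wedge$; each of $\mathsf{AA}$, $\mathsf{AG}^\vee$, $\mathsf{AG}^\wedge$ implies $\mathsf{Coop}$; and $\mathsf{Coop}$ implies $\mathsf{RS}^\exists(\mathsf{NE})$. 2. For all games with $\omega$-regular objectives: $\mathsf{Win}$ implies $\mathsf{RS}^\exists(\mathsf{SPE})$ and $\mathsf{RS}^\forall(\mathsf{SPE})$; $\mathsf{Coop}$ implies $\mathsf{RS}^\exists(\mathsf{SPE})$; and if there are exactly two players, $\mathsf{AA}$ implies $\mathsf{AG}^\wedge$. 3. There are games, whose objectives are all Muller conditions, such that: - (two players) $\mathsf{AG}^\vee$ and $\mathsf{AG}^\wedge$ have solutions, but $\mathsf{AA}$ and $\mathsf{Win}$ have none; - (three players) $\mathsf{AA}$ has a solution, but $\mathsf{AG}^\wedge$, $\mathsf{AG}^\vee$ and $\mathsf{Win}$ have none; - (two players) $\mathsf{Coop}$ has a solution, but $\mathsf{AA}$ and $\mathsf{Win}$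 have none; - (two players) $\mathsf{Coop}$ has a solution, but $\mathsf{AG}^\wedge$ and $\mathsf{AG}^\vee$ have none; - (three players) $\mathsf{Coop}$ has a solution, but $\mathsf{RS}^\exists(\mathsf{Dom})$ and $\mathsf{RS}^\forall(\mathsf{Dom})$ have none; - (two players) all six rules $\mathsf{RS}^\exists(\gamma)$, $\mathsf{RS}^\forall(\gamma)$ have solutions, but $\mathsf{Coop}$, $\mathsf{AA}$, $\mathsf{AG}^\wedge$, $\mathsf{AG}^\vee$ and $\mathsf{Win}$ have none. -/

import Mathlib

universe u v w

/-- Turn-based multiplayer arena with set of players `Agt`. The states are the disjoint union of the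
finite sets `Stat i` of player-`i` states, and in a state of player `i` the transition function is
applied to an action of player `i`. -/
structure Arena (Agt : Type u) where
  Stat : Agt → Type v
  finite_stat : ∀ i, Finite (Stat i)
  init : Σ i, Stat i
  Act : Agt → Type w
  δ : (s : Σ i, Stat i) → Act s.1 → Σ i, Stat i

namespace Arena

variable {Agt : Type u}

/-- All states. -/
abbrev State (A : Arena.{u, v, w} Agt) : Type (max u v) := Σ i, A.Stat i

/-- A state together with an action of the player who controls it. -/
abbrev Step (A : Arena.{u, v, w} Agt) : Type (max u v w) := Σ s : A.State, A.Act s.1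

/-- The alternating sequence `s₁ a₁ s₂ a₂ …` is a run, i.e. it respects the transition function. -/
def IsRun (A : Arena.{u, v, w} Agt) (ρ : ℕ → A.Step) : Prop :=
  ∀ n, A.δ (ρ n).1 (ρ n).2 = (ρ (n + 1)).1

/-- The first `n` steps of `ρ`; with the state `(ρ n).1` they form a history. -/
def hist (A : Arena.{u, v, w} Agt) (ρ : ℕ → A.Step) (n : ℕ) : List A.Step :=
  (List.range n).map ρ

/-- `h` followed by the last state `s` is a history: a finite prefix of a run, ending in a state. -/
def IsHistory (A : Arena.{u, v, w} Agt) (h : List A.Step) (s : A.State) : Prop :=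
  ∃ ρ, A.IsRun ρ ∧ h = A.hist ρ h.length ∧ (ρ h.length).1 = s

/-- The concatenation `h · ρ`. -/
def glue (A : Arena.{u, v, w} Agt) (h : List A.Step) (ρ : ℕ → A.Step) : ℕ → A.Step :=
  fun n => h.getD n (ρ (n - h.length))

/-- A strategy of player `i` maps every history that ends in a player-`i` state to an action of
player `i`; the history is given as its steps and its last state. -/
abbrev Strategy (A : Arena.{u, v, w} Agt) (i : Agt) : Type (max u v w) :=
  List A.Step → A.Stat i → A.Act i

/-- A strategy for every player. -/
abbrev Profile (A : Arena.{u, v, w} Agt) : Type (max u v w) := ∀ i, A.Strategy i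

/-- The profile `σ ∘ h`. -/
def shift (A : Arena.{u, v, w} Agt) (σ : A.Profile) (h : List A.Step) : A.Profile :=
  fun i h' x => σ i (h ++ h') x

/-- `ρ` is compatible with the strategy `τ` of player `i`. -/
def Compatible (A : Arena.{u, v, w} Agt) {i : Agt} (τ : A.Strategy i) (ρ : ℕ → A.Step) : Prop :=
  ∀ (n : ℕ) (x : A.Stat i), (ρ n).1 = ⟨i, x⟩ → ρ n = ⟨⟨i, x⟩, τ (A.hist ρ n) x⟩

/-- The runs from `s` that are compatible with the strategies in `σ` of the players in `P`. -/
def outcomes (A : Arena.{u, v, w} Agt) (s : A.State) (P : Set Agt) (σ : A.Profile) :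
    Set (ℕ → A.Step) :=
  {ρ | A.IsRun ρ ∧ (ρ 0).1 = s ∧ ∀ i ∈ P, A.Compatible (σ i) ρ}

/-- From the state `s` and with objectives `obj`, no player in `E` improves by deviating alone from
the profile `σ`. -/
def NashFrom (A : Arena.{u, v, w} Agt) [DecidableEq Agt] (s : A.State)
    (obj : Agt → Set (ℕ → A.Step)) (E : Set Agt) (σ : A.Profile) : Prop :=
  ∀ i ∈ E, ∀ τ : A.Strategy i,
    A.outcomes s Set.univ (Function.update σ i τ) ⊆ obj i → A.outcomes s Set.univ σ ⊆ obj i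

/-- Muller objective: membership of a run depends on its set of infinitely visited states. -/
def IsMuller (A : Arena.{u, v, w} Agt) (φ : Set (ℕ → A.Step)) : Prop :=
  ∃ F : Set (Set A.State), ∀ ρ, A.IsRun ρ →
    (ρ ∈ φ ↔ {s | ∃ᶠ n in Filter.atTop, (ρ n).1 = s} ∈ F)

/-- ω-regular objective: the runs in it are those accepted by some finite deterministic Muller
automaton that reads the run. -/
def IsOmegaRegular (A : Arena.{u, v, w} Agt) (φ : Set (ℕ → A.Step)) : Prop :=
  ∃ (k : ℕ) (q₀ : Fin k) (step : Fin k → A.Step → Fin k) (F : Set (Set (Fin k))),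
    ∀ ρ, A.IsRun ρ →
      (ρ ∈ φ ↔ {q | ∃ᶠ n in Filter.atTop, (A.hist ρ n).foldl step q₀ = q} ∈ F)

/-- The objective that remains of `φ` after `h`. -/
def residual (A : Arena.{u, v, w} Agt) (h : List A.Step) (φ : Set (ℕ → A.Step)) :
    Set (ℕ → A.Step) :=
  {ρ | A.glue h ρ ∈ φ}

end Arena

/-- A game: an arena with an objective for each player. Only the runs in an objective matter. -/
structure ArenaGame (Agt : Type u) extends Arena.{u, v, w} Agt where
  obj : Agt → Set (ℕ → toArena.Step)

/-- The solution concepts for the environment. -/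
inductive SolutionConcept
  | NE
  | SPE
  | dom

namespace ArenaGame

variable {Agt : Type u}

/-- `σ_P ⊨ φ`, for the strategies in `σ` of the players in `P`. -/
def Models (G : ArenaGame.{u, v, w} Agt) (P : Set Agt) (σ : G.Profile)
    (φ : Set (ℕ → G.Step)) : Prop :=
  G.outcomes G.init P σ ⊆ φ

/-- Rule Coop. -/
def Coop (G : ArenaGame.{u, v, w} Agt) : Prop :=
  ∃ σ : G.Profile, G.Models Set.univ σ {ρ | ∀ i, ρ ∈ G.obj i}

/-- Rule Win. -/
def Win (G : ArenaGame.{u, v, w} Agt) : Prop :=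
  ∃ σ : G.Profile, ∀ i, G.Models {i} σ (G.obj i)

/-- Rule AG-and. -/
def AGAnd (G : ArenaGame.{u, v, w} Agt) : Prop :=
  ∃ σ : G.Profile, G.Models Set.univ σ {ρ | ∀ i, ρ ∈ G.obj i} ∧
    ∀ i, G.Models {i} σ {ρ | (∀ j, j ≠ i → ρ ∈ G.obj j) → ρ ∈ G.obj i}

/-- Rule AG-or. -/
def AGOr (G : ArenaGame.{u, v, w} Agt) : Prop :=
  ∃ σ : G.Profile, G.Models Set.univ σ {ρ | ∀ i, ρ ∈ G.obj i} ∧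
    ∀ i, G.Models {i} σ {ρ | (∃ j, j ≠ i ∧ ρ ∈ G.obj j) → ρ ∈ G.obj i}

/-- The profile `(τ, σ_{-i})` makes player `i` win. -/
def WinsAgainst (G : ArenaGame.{u, v, w} Agt) [DecidableEq Agt] {i : Agt} (τ : G.Strategy i)
    (σ : G.Profile) : Prop :=
  G.Models Set.univ (Function.update σ i τ) (G.obj i)

/-- The strategy `τ` of player `i` is (weakly) dominated by `τ'`. -/
def DominatedBy (G : ArenaGame.{u, v, w} Agt) [DecidableEq Agt] {i : Agt}
    (τ τ' : G.Strategy i) : Prop :=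
  (∀ σ : G.Profile, G.WinsAgainst τ σ → G.WinsAgainst τ' σ) ∧
    ∃ σ : G.Profile, G.WinsAgainst τ' σ ∧ ¬ G.WinsAgainst τ σ

/-- Admissible strategies. -/
def Admissible (G : ArenaGame.{u, v, w} Agt) [DecidableEq Agt] {i : Agt} (τ : G.Strategy i) :
    Prop :=
  ¬ ∃ τ' : G.Strategy i, G.DominatedBy τ τ'

/-- Rule AA. -/
def AA (G : ArenaGame.{u, v, w} Agt) [DecidableEq Agt] : Prop :=
  ∃ σ : G.Profile, (∀ i, G.Admissible (σ i)) ∧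
    ∀ i, ∀ σ' : G.Profile, (∀ j, j ≠ i → G.Admissible (σ' j)) → G.WinsAgainst (σ i) σ'

/-- `σ_{-sys}` is stable, in the sense of the solution concept, in the game in which player `sys`
plays `σ sys`. For `SPE`, the profile `σ ∘ h` has to be a Nash equilibrium of the environment players
from the last state of `h`, for every history `h`, where an objective is evaluated on the whole run,
including `h`; for Muller objectives this is the same as evaluating it on the run after `h`. -/
def Stable (G : ArenaGame.{u, v, w} Agt) [DecidableEq Agt] (sys : Agt) (σ : G.Profile) :
    SolutionConcept → Prop
  | SolutionConcept.NE => G.NashFrom G.init G.obj {i | i ≠ sys} σ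
  | SolutionConcept.SPE => ∀ (h : List G.Step) (s : G.State), G.IsHistory h s →
      G.NashFrom s (fun i => G.residual h (G.obj i)) {i | i ≠ sys} (G.shift σ h)
  | SolutionConcept.dom => ∀ j, j ≠ sys → ∀ (τ : G.Strategy j) (σ' : G.Profile), σ' sys = σ sys →
      G.WinsAgainst τ σ' → G.WinsAgainst (σ j) σ'

/-- Existential rational synthesis, where `sys` is the system player. -/
def RSExists (G : ArenaGame.{u, v, w} Agt) [DecidableEq Agt] (sys : Agt)
    (γ : SolutionConcept) : Prop :=
  ∃ σ : G.Profile, G.Stable sys σ γ ∧ G.Models Set.univ σ (G.obj sys)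

/-- Universal rational synthesis, where `sys` is the system player. -/
def RSForall (G : ArenaGame.{u, v, w} Agt) [DecidableEq Agt] (sys : Agt)
    (γ : SolutionConcept) : Prop :=
  ∃ τ : G.Strategy sys, (∃ σ : G.Profile, σ sys = τ ∧ G.Stable sys σ γ) ∧
    ∀ σ : G.Profile, σ sys = τ → G.Stable sys σ γ → G.Models Set.univ σ (G.obj sys)

/-- All objectives are ω-regular. -/
def OmegaRegular (G : ArenaGame.{u, v, w} Agt) : Prop := ∀ i, G.IsOmegaRegular (G.obj i)

/-- All objectives are Muller conditions. -/
def Muller (G : ArenaGame.{u, v, w} Agt) : Prop := ∀ i, G.IsMuller (G.obj i)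

end ArenaGame

/-! The implications for arbitrary objectives are short: a strategy that wins against everybody
meets every obligation, and nobody can improve on a run that everybody wins. The weight lies in the
ω-regular statements, which rest on determinacy on the tree of histories. There a latest appearance
record turns an ω-regular objective into a parity condition with boundedly many colours
(`exists_color`). The tree may be infinite, so positional determinacy is proved on arbitrary graphs
(`parity_determined`); a positional strategy on the tree is an ordinary strategy.

For subgame perfect equilibria, let players commit to moves at vertices from which they win whatever
the uncommitted moves are, and take a maximal such commitment (`exists_punishing_commitment`). By
determinacy, wherever player `i` has no guaranteed win, the others can make `i` lose while keeping
all commitments. Everybody follows the commitments and punishes the last deviator, so no deviation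
pays (`exists_subgamePerfect`). Starting from the winning region of the system makes its strategy
winning, if it has a winning one. For Coop, the equilibrium is used only off a cooperative run.

For AA with two players, an admissible strategy never leaves its owner's winning region
(`Admissible.mem_winningRegion`), and conversely a won run that never leaves that region is
compatible with an admissible strategy (`exists_admissible_of_run`). Punish an opponent who has left
her winning region: then every run that the opponent wins is a run against one of her admissible
strategies, and AA applies (`AA.agAnd`).

The separating examples are games with two binary moves, where a strategy matters only through a
first move or a reply to it. -/

/-! ### Positional determinacy of parity games on arbitrary graphs -/

namespace GraphGame

open Filter Classical

variable {V : Type*}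

/-- Zorn's lemma for pairs of a set and a function that is pinned on the preimage of the set. -/
theorem exists_maximal_extension {ι : Type*} (g : V → ι) (P : Set ι → (V → V) → Prop)
    (hchain : ∀ C : Set (Set ι × (V → V)), C.Nonempty → (∀ p ∈ C, P p.1 p.2) →
      ∀ s : V → V, (∀ p ∈ C, ∀ v, g v ∈ p.1 → s v = p.2 v) → P {x | ∃ p ∈ C, x ∈ p.1} s)
    (R₀ : Set ι) (s₀ : V → V) (h₀ : P R₀ s₀) :
    ∃ R s, P R s ∧ R₀ ⊆ R ∧ (∀ v, g v ∈ R₀ → s v = s₀ v) ∧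
      ∀ R' s', P R' s' → R ⊆ R' → (∀ v, g v ∈ R → s' v = s v) → R' ⊆ R := by
  -- Only a preorder: the functions are unconstrained off the preimage of the set. Maximality is
  -- therefore concluded for the sets alone.
  let r : (Set ι × (V → V)) → (Set ι × (V → V)) → Prop :=
    fun p q => p.1 ⊆ q.1 ∧ ∀ v, g v ∈ p.1 → q.2 v = p.2 v
  have rrefl : ∀ p, r p p := fun p => ⟨subset_rfl, fun _ _ => rfl⟩
  have rtrans : ∀ {p q t}, r p q → r q t → r p t := fun {p q t} h1 h2 =>
    ⟨h1.1.trans h2.1, fun v hv => (h2.2 v (h1.1 hv)).trans (h1.2 v hv)⟩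
  let α := {p : Set ι × (V → V) // P p.1 p.2 ∧ r (R₀, s₀) p}
  obtain ⟨m, hm⟩ : ∃ m : α, ∀ a : α, r m.1 a.1 → r a.1 m.1 := by
    refine exists_maximal_of_chains_bounded (r := fun a b : α => r a.1 b.1) ?_
      (fun {a b c} => rtrans)
    intro C hC
    rcases C.eq_empty_or_nonempty with rfl | ⟨p₀, hp₀⟩
    · exact ⟨⟨(R₀, s₀), h₀, rrefl _⟩, by simp⟩
    let s : V → V := fun v => if h : ∃ p ∈ C, g v ∈ p.1.1 then h.choose.1.2 v else v
    have hs : ∀ p ∈ C, ∀ v, g v ∈ p.1.1 → s v = p.1.2 v := by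
      intro p hp v hv
      have h : ∃ p ∈ C, g v ∈ p.1.1 := ⟨p, hp, hv⟩
      have hsv : s v = h.choose.1.2 v := dif_pos h
      rw [hsv]
      have : Std.Refl (fun a b : α => r a.1 b.1) := ⟨fun a => rrefl a.1⟩
      rcases hC.total hp h.choose_spec.1 with hr | hr
      · exact hr.2 v hv
      · exact (hr.2 v h.choose_spec.2).symm
    have hP : P {x | ∃ p ∈ Subtype.val '' C, x ∈ p.1} s := by
      refine hchain (Subtype.val '' C) ⟨_, p₀, hp₀, rfl⟩ ?_ s ?_
      · rintro _ ⟨p, _, rfl⟩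
        exact p.2.1
      · rintro _ ⟨p, hp, rfl⟩
        exact hs p hp
    have hub : ∀ p ∈ C, r p.1 ({x | ∃ p ∈ Subtype.val '' C, x ∈ p.1}, s) := fun p hp =>
      ⟨fun x hx => ⟨p.1, ⟨p, hp, rfl⟩, hx⟩, hs p hp⟩
    exact ⟨⟨_, hP, rtrans p₀.2.2 (hub p₀ hp₀)⟩, hub⟩
  refine ⟨m.1.1, m.1.2, m.2.1, m.2.2.1, m.2.2.2, fun R' s' hP hR hs => ?_⟩
  exact (hm ⟨(R', s'), hP, rtrans m.2.2 ⟨hR, hs⟩⟩ ⟨hR, hs⟩).1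

/-- `R` is a region in the arena `X` in which the player who owns the vertices in `own` wins with
the positional strategy `s`; the game stops in `D`, where the player wins. -/
structure Dominion (E : V → V → Prop) (own : V → Prop) (X D : Set V) (win : (ℕ → V) → Prop)
    (R : Set V) (s : V → V) : Prop where
  sub : R ⊆ X
  move : ∀ v ∈ R, v ∉ D → own v → E v (s v) ∧ s v ∈ R
  closed : ∀ v ∈ R, v ∉ D → ¬ own v → ∀ w ∈ X, E v w → w ∈ R
  wins : ∀ π : ℕ → V, (∀ n, E (π n) (π (n + 1))) → (∀ n, own (π n) → π (n + 1) = s (π n)) →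
    (∀ n, π n ∈ R ∧ π n ∉ D) → win π

section Dominion

variable {E : V → V → Prop} {own : V → Prop} {X D : Set V} {win : (ℕ → V) → Prop} {R : Set V}
  {s : V → V}

theorem Dominion.mem_of_mem (h : Dominion E own X D win R s) {π : ℕ → V}
    (hE : ∀ n, E (π n) (π (n + 1))) (hX : ∀ n, π n ∈ X) (hD : ∀ n, π n ∉ D)
    (hs : ∀ n, π n ∈ R → own (π n) → π (n + 1) = s (π n)) {m : ℕ} (hm : π m ∈ R) (n : ℕ) :
    π (n + m) ∈ R := by
  induction n with
  | zero => simpa using hm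
  | succ n ih =>
    rw [Nat.add_right_comm]
    by_cases ho : own (π (n + m))
    · rw [hs _ ih ho]
      exact (h.move _ ih (hD _) ho).2
    · exact h.closed _ ih (hD _) ho _ (hX _) (hE _)

theorem Dominion.wins_of_mem (h : Dominion E own X D win R s)
    (htail : ∀ (π : ℕ → V) k, win (fun n => π (n + k)) → win π) {π : ℕ → V}
    (hE : ∀ n, E (π n) (π (n + 1))) (hX : ∀ n, π n ∈ X) (hD : ∀ n, π n ∉ D)
    (hs : ∀ n, π n ∈ R → own (π n) → π (n + 1) = s (π n)) {m : ℕ} (hm : π m ∈ R) : win π := by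
  have hmem := h.mem_of_mem hE hX hD hs hm
  refine htail π m (h.wins _ (fun n => ?_) (fun n ho => ?_) fun n => ⟨hmem n, hD _⟩)
  · have := hE (n + m)
    rwa [Nat.add_right_comm] at this
  · have := hs (n + m) (hmem n) ho
    rwa [Nat.add_right_comm] at this

/-- Dominions pass to unions of chains: a play in the union starts in some member, cannot leave it,
and is won there. -/
theorem exists_maximal_dominion (h₀ : Dominion E own X D win R s) :
    ∃ R' s', Dominion E own X D win R' s' ∧ R ⊆ R' ∧
      ∀ R'' s'', Dominion E own X D win R'' s'' → R' ⊆ R'' → (∀ v ∈ R', s'' v = s' v) →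
        R'' ⊆ R' := by
  suffices hchain : _ by
    obtain ⟨R', s', h, hR, -, hmax⟩ := exists_maximal_extension (id : V → V)
      (Dominion E own X D win) hchain R s h₀
    exact ⟨R', s', h, hR, hmax⟩
  intro C _ hC t ht
  refine ⟨?_, ?_, ?_, ?_⟩
  · rintro v ⟨p, hp, hv⟩
    exact (hC p hp).sub hv
  · rintro v ⟨p, hp, hv⟩ hD ho
    rw [ht p hp v hv]
    exact ⟨((hC p hp).move v hv hD ho).1, p, hp, ((hC p hp).move v hv hD ho).2⟩
  · rintro v ⟨p, hp, hv⟩ hD ho w hw hE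
    exact ⟨p, hp, (hC p hp).closed v hv hD ho w hw hE⟩
  · intro π hE hs hR
    obtain ⟨p, hp, hv⟩ := (hR 0).1
    have hX : ∀ n, π n ∈ X := fun n => by
      obtain ⟨q, hq, hv⟩ := (hR n).1
      exact (hC q hq).sub hv
    have hs' : ∀ n, π n ∈ p.1 → own (π n) → π (n + 1) = p.2 (π n) := fun n hn ho => by
      rw [hs n ho, ht p hp _ hn]
    have hmem := (hC p hp).mem_of_mem hE hX (fun n => (hR n).2) hs' hv
    exact (hC p hp).wins π hE (fun n ho => hs' n (hmem n) ho) fun n => ⟨hmem n, (hR n).2⟩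

/-- A maximal dominion absorbs every set in which its player wins or moves into the dominion. -/
theorem Dominion.absorb (h : Dominion E own X D win R s)
    (hmax : ∀ R' s', Dominion E own X D win R' s' → R ⊆ R' → (∀ v ∈ R, s' v = s v) → R' ⊆ R)
    (htail : ∀ (π : ℕ → V) k, win (fun n => π (n + k)) → win π) (Q : Set V) (t : V → V)
    (hsub : Q ⊆ X)
    (hmove : ∀ v ∈ Q, v ∉ R → own v → E v (t v) ∧ (t v ∈ R ∨ t v ∈ Q))
    (hclosed : ∀ v ∈ Q, v ∉ R → ¬ own v → ∀ w ∈ X, E v w → w ∈ R ∨ w ∈ Q)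
    (hwins : ∀ π : ℕ → V, (∀ n, E (π n) (π (n + 1))) → (∀ n, own (π n) → π (n + 1) = t (π n)) →
      (∀ n, π n ∈ Q ∧ π n ∉ R) → win π) : Q ⊆ R := by
  have hd : Dominion E own X D win (R ∪ Q) (fun v => if v ∈ R then s v else t v) := by
    refine ⟨Set.union_subset h.sub hsub, ?_, ?_, ?_⟩
    · intro v hv hD ho
      by_cases hR : v ∈ R
      · simpa only [hR, if_true] using ⟨(h.move v hR hD ho).1, Or.inl (h.move v hR hD ho).2⟩
      · simpa only [hR, if_false, Set.mem_union] using hmove v (hv.resolve_left hR) hR ho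
    · intro v hv hD ho w hw hE
      by_cases hR : v ∈ R
      · exact Or.inl (h.closed v hR hD ho w hw hE)
      · exact hclosed v (hv.resolve_left hR) hR ho w hw hE
    · intro π hE hs hR
      by_cases hex : ∃ m, π m ∈ R
      · obtain ⟨m, hm⟩ := hex
        refine h.wins_of_mem htail hE (fun n => ?_) (fun n => (hR n).2) (fun n hn ho => ?_) hm
        · exact Set.union_subset h.sub hsub (hR n).1
        · rw [hs n ho, if_pos hn]
      · push Not at hex
        refine hwins π hE (fun n ho => ?_) fun n => ⟨(hR n).1.resolve_left (hex n), hex n⟩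
        rw [hs n ho, if_neg (hex n)]
  exact Set.subset_union_right.trans
    (hmax _ _ hd Set.subset_union_left fun v hv => if_pos hv)

end Dominion

/-- The limes superior of a sequence of natural numbers is `k`. -/
def LimsupEq (x : ℕ → ℕ) (k : ℕ) : Prop :=
  (∃ᶠ n in atTop, x n = k) ∧ ∀ᶠ n in atTop, x n ≤ k

theorem LimsupEq.unique {x : ℕ → ℕ} {k l : ℕ} (hk : LimsupEq x k) (hl : LimsupEq x l) : k = l := by
  obtain ⟨n, h1, h2⟩ := (hk.1.and_eventually hl.2).exists
  obtain ⟨m, h3, h4⟩ := (hl.1.and_eventually hk.2).exists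
  omega

theorem limsupEq_shift (x : ℕ → ℕ) (k m : ℕ) :
    LimsupEq (fun n => x (n + m)) k ↔ LimsupEq x k := by
  have h1 := Filter.map_add_atTop_eq_nat m
  have h2 : (∃ᶠ n in map (· + m) atTop, x n = k) ∧ (∀ᶠ n in map (· + m) atTop, x n ≤ k) ↔
      LimsupEq (fun n => x (n + m)) k := by
    rw [Filter.frequently_map, Filter.eventually_map]
    rfl
  rw [← h2, h1]
  rfl

/-- The player `true` wins if the largest colour seen infinitely often is even, and the player
`false` wins if it is odd. -/
def ParityWin (c : V → ℕ) (b : Bool) (π : ℕ → V) : Prop :=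
  ∃ k, LimsupEq (fun n => c (π n)) k ∧ (Even k ↔ b = true)

theorem parityWin_shift (c : V → ℕ) (b : Bool) (π : ℕ → V) (m : ℕ) :
    ParityWin c b (fun n => π (n + m)) ↔ ParityWin c b π :=
  exists_congr fun k => and_congr_left fun _ => limsupEq_shift (fun n => c (π n)) k m

theorem ParityWin.false_of_not {c : V → ℕ} {b : Bool} {π : ℕ → V} (h : ParityWin c b π)
    (h' : ParityWin c (!b) π) : False := by
  obtain ⟨k, hk, hkb⟩ := h
  obtain ⟨l, hl, hlb⟩ := h'
  obtain rfl := hk.unique hl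
  cases b <;> simp_all

/-- Parity games with boundedly many colours are positionally determined. -/
theorem parity_determined (E : V → V → Prop) (own : V → Bool) (c : V → ℕ) (d : ℕ) :
    ∀ X : Set V, (∀ v ∈ X, ∃ w ∈ X, E v w) → (∀ v ∈ X, c v < d) →
      ∃ (R : Bool → Set V) (s : Bool → V → V), (∀ v ∈ X, v ∈ R true ∨ v ∈ R false) ∧
        ∀ b, Dominion E (fun v => own v = b) X ∅ (ParityWin c b) (R b) (s b) := by
  induction d with
  | zero =>
    intro X _ hc
    refine ⟨fun _ => ∅, fun _ => id, fun v hv => absurd (hc v hv) (by simp), fun b => ?_⟩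
    exact ⟨by simp, by simp, by simp, fun π _ _ h => absurd (h 0).1 (by simp)⟩
  | succ d ih =>
    intro X hX hc
    -- `b` is the player favoured by the top colour `d`. The goal is that `b` wins everywhere
    -- outside a maximal dominion `R` of the opponent.
    obtain ⟨b, hb⟩ : ∃ b : Bool, Even d ↔ b = true := ⟨decide (Even d), by simp⟩
    have hown : ∀ v b', ¬ own v = b' ↔ own v = !b' := fun v b' => by
      cases own v <;> cases b' <;> simp
    have htail : ∀ b' (π : ℕ → V) k, ParityWin c b' (fun n => π (n + k)) → ParityWin c b' π :=
      fun b' π k => (parityWin_shift c b' π k).1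
    obtain ⟨R, s, hR, -, hmax⟩ := exists_maximal_dominion
      (E := E) (own := fun v => own v = !b) (X := X) (D := ∅) (win := ParityWin c (!b))
      (R := ∅) (s := id) ⟨by simp, by simp, by simp, fun π _ _ h => absurd (h 0).1 (by simp)⟩
    -- edges of the opponent out of the complement `Y` of the maximal dominion stay in `Y`
    have hY1 : ∀ v ∈ X, v ∉ R → (own v = !b) → ∀ w ∈ X, E v w → w ∉ R := by
      intro v hv hvR ho w hw hE hwR
      refine hvR (hR.absorb hmax (htail _) {v} (fun _ => w) (by simpa using hv) ?_ ?_ ?_ rfl)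
      · rintro _ rfl _ _
        exact ⟨hE, Or.inl hwR⟩
      · rintro _ rfl _ h
        exact absurd ho h
      · intro π _ hs hQ
        refine absurd hwR (hs 0 ?_ ▸ (hQ 1).2)
        rw [(hQ 0).1]
        exact ho
    have hY2 : ∀ v ∈ X, v ∉ R → own v = b → ∃ w ∈ X, w ∉ R ∧ E v w := by
      intro v hv hvR ho
      by_contra! hcon
      refine hvR (hR.absorb hmax (htail _) {v} id (by simpa using hv) ?_ ?_ ?_ rfl)
      · rintro _ rfl _ h
        simp [ho] at h
      · rintro _ rfl _ _ w hw hE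
        by_contra! h
        exact hcon w hw h.1 hE
      · intro π hE _ hQ
        have h1 : π 1 = v := (hQ 1).1
        have h0 : π 0 = v := (hQ 0).1
        have := hE 0
        rw [zero_add, h1, h0] at this
        exact absurd this (hcon v hv hvR)
    have hYtot : ∀ v ∈ X \ R, ∃ w ∈ X \ R, E v w := by
      rintro v ⟨hv, hvR⟩
      by_cases ho : own v = b
      · obtain ⟨w, hw, hwR, hE⟩ := hY2 v hv hvR ho
        exact ⟨w, ⟨hw, hwR⟩, hE⟩
      · obtain ⟨w, hw, hE⟩ := hX v hv
        exact ⟨w, ⟨hw, hY1 v hv hvR ((hown v b).1 ho) w hw hE⟩, hE⟩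
    -- the attractor of the vertices of colour `d`
    obtain ⟨Z, z, hZ, hDZ, hZmax⟩ := exists_maximal_dominion
      (E := E) (own := fun v => own v = b) (X := X \ R) (D := {v | c v = d})
      (win := fun _ => False) (R := {v | v ∈ X \ R ∧ c v = d}) (s := id)
      ⟨fun v hv => hv.1, fun v hv hD => absurd hv.2 hD, fun v hv hD => absurd hv.2 hD,
        fun π _ _ h => (h 0).2 (h 0).1.2⟩
    have hU1 : ∀ v ∈ X \ R, v ∉ Z → own v = b → ∀ w ∈ X \ R, E v w → w ∉ Z := by
      intro v hv hvZ ho w hw hE hwZ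
      refine hvZ (hZ.absorb hZmax (fun _ _ => id) {v} (fun _ => w) (by simpa using hv) ?_ ?_ ?_ rfl)
      · rintro _ rfl _ _
        exact ⟨hE, Or.inl hwZ⟩
      · rintro _ rfl _ h
        exact absurd ho h
      · intro π _ hs hQ
        refine absurd hwZ (hs 0 ?_ ▸ (hQ 1).2)
        rw [(hQ 0).1]
        exact ho
    have hU2 : ∀ v ∈ X \ R, v ∉ Z → own v = (!b) → ∃ w ∈ X \ R, w ∉ Z ∧ E v w := by
      intro v hv hvZ ho
      by_contra! hcon
      refine hvZ (hZ.absorb hZmax (fun _ _ => id) {v} id (by simpa using hv) ?_ ?_ ?_ rfl)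
      · rintro _ rfl _ h
        simp [ho] at h
      · rintro _ rfl _ _ w hw hE
        by_contra! h
        exact hcon w hw h.1 hE
      · intro π hE _ hQ
        have h1 : π 1 = v := (hQ 1).1
        have h0 : π 0 = v := (hQ 0).1
        have := hE 0
        rw [zero_add, h1, h0] at this
        exact absurd this (hcon v hv hvZ)
    obtain ⟨R', s', hcov, hdom⟩ := ih ((X \ R) \ Z)
      (by
        rintro v ⟨hv, hvZ⟩
        by_cases ho : own v = b
        · obtain ⟨w, hw, hE⟩ := hYtot v hv
          exact ⟨w, ⟨hw, hU1 v hv hvZ ho w hw hE⟩, hE⟩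
        · obtain ⟨w, hw, hwZ, hE⟩ := hU2 v hv hvZ ((hown v b).1 ho)
          exact ⟨w, ⟨hw, hwZ⟩, hE⟩)
      (by
        rintro v ⟨hv, hvZ⟩
        exact lt_of_le_of_ne (Nat.le_of_lt_succ (hc v hv.1)) fun h => hvZ (hDZ ⟨hv, h⟩))
    -- Outside `Z`, player `b` can leave the subgame only into `R`, so a dominion of the opponent
    -- there would be absorbed by `R`.
    have hempty : ∀ v, v ∉ R' (!b) := by
      have hsub : R' (!b) ⊆ R := by
        refine hR.absorb hmax (htail _) _ (s' (!b)) (fun v hv => ((hdom _).sub hv).1.1) ?_ ?_ ?_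
        · intro v hv _ ho
          have := (hdom (!b)).move v hv (by simp) ho
          exact ⟨this.1, Or.inr this.2⟩
        · intro v hv hvR ho w hw hE
          by_cases hwR : w ∈ R
          · exact Or.inl hwR
          · have hvU := (hdom _).sub hv
            have ho' : own v = b := by simpa using (hown v (!b)).1 ho
            exact Or.inr ((hdom (!b)).closed v hv (by simp) ho w
              ⟨⟨hw, hwR⟩, hU1 v hvU.1 hvU.2 ho' w ⟨hw, hwR⟩ hE⟩ hE)
        · intro π hE hs hQ
          exact (hdom (!b)).wins π hE hs fun n => ⟨(hQ n).1, by simp⟩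
      intro v hv
      exact ((hdom _).sub hv).1.2 (hsub hv)
    have hU : ∀ v ∈ X \ R, v ∉ Z → v ∈ R' b := by
      intro v hv hvZ
      have h1 := hcov v ⟨hv, hvZ⟩
      have h2 := hempty v
      cases b <;> simp_all
    choose! nxt hnxt using hYtot
    -- Player `b` heads for colour `d` inside `Z`, takes any step within `X \ R` on reaching it, and
    -- uses the induction hypothesis outside `Z`.
    let t : V → V := fun v => if v ∈ Z then if c v = d then nxt v else z v else s' b v
    have hdomY : Dominion E (fun v => own v = b) X ∅ (ParityWin c b) (X \ R) t := by
      refine ⟨fun v hv => hv.1, ?_, ?_, ?_⟩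
      · intro v hv _ ho
        by_cases hvZ : v ∈ Z
        · by_cases hd : c v = d
          · simp only [t, hvZ, hd, if_true]
            exact ⟨(hnxt v hv).2, (hnxt v hv).1⟩
          · simp only [t, hvZ, hd, if_true, if_false]
            have := hZ.move v hvZ hd ho
            exact ⟨this.1, hZ.sub this.2⟩
        · simp only [t, hvZ, if_false]
          have := (hdom b).move v (hU v hv hvZ) (by simp) ho
          exact ⟨this.1, ((hdom b).sub this.2).1⟩
      · intro v hv _ ho w hw hE
        exact ⟨hw, hY1 v hv.1 hv.2 ((hown v b).1 ho) w hw hE⟩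
      · intro π hE hs hY
        by_cases hfreq : ∃ᶠ n in atTop, c (π n) = d
        · exact ⟨d, ⟨hfreq, Eventually.of_forall fun n =>
            Nat.le_of_lt_succ (hc _ (hY n).1.1)⟩, hb⟩
        · rw [not_frequently, eventually_atTop] at hfreq
          obtain ⟨N, hN⟩ := hfreq
          have hE' : ∀ n, E (π (n + N)) (π (n + 1 + N)) := fun n => by
            rw [Nat.add_right_comm]
            exact hE _
          have hs' : ∀ n, own (π (n + N)) = b → π (n + 1 + N) = t (π (n + N)) := fun n ho => by
            rw [Nat.add_right_comm]
            exact hs _ ho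
          -- Inside `Z` the colour `d` would be forced, but it no longer occurs after `N`.
          have hnZ : ∀ m, π (m + N) ∉ Z := by
            intro m hm
            refine hZ.wins_of_mem (fun _ _ => id) (π := fun n => π (n + N)) hE'
              (fun n => (hY _).1) (fun n => hN _ (by omega)) (fun n hn ho => ?_) hm
            rw [hs' n ho]
            have hd : ¬ c (π (n + N)) = d := hN _ (by omega)
            simp only [t, hn, hd, if_true, if_false]
          refine htail b π N ((hdom b).wins _ hE' (fun n ho => ?_) fun n => ⟨?_, by simp⟩)
          · rw [hs' n ho]
            simp only [t, hnZ n, if_false]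
          · exact hU _ (hY _).1 (hnZ n)
    refine ⟨fun b' => if b' = b then X \ R else R, fun b' => if b' = b then t else s, ?_, ?_⟩
    · intro v hv
      by_cases hvR : v ∈ R <;> cases b <;> simp [hv, hvR]
    · intro b'
      by_cases hbb : b' = b
      · subst hbb
        simpa using hdomY
      · obtain rfl : b' = !b := by cases b <;> cases b' <;> simp_all
        simpa using hR

end GraphGame

/-! ### Commitments of several players -/

namespace GraphGame

open Filter Classical

variable {V Agt : Type*}

/-- Play on from `v` with the successor function `f`. -/
theorem exists_play {E : V → V → Prop} {S : Set V} {f : V → V}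
    (hf : ∀ v ∈ S, E v (f v) ∧ f v ∈ S) {v : V} (hv : v ∈ S) :
    ∃ π : ℕ → V, π 0 = v ∧ (∀ n, π (n + 1) = f (π n)) ∧ (∀ n, π n ∈ S) ∧
      ∀ n, E (π n) (π (n + 1)) := by
  have hmem : ∀ n, f^[n] v ∈ S := by
    intro n
    induction n with
    | zero => exact hv
    | succ n ih =>
      rw [Function.iterate_succ_apply']
      exact (hf _ ih).2
  refine ⟨fun n => f^[n] v, rfl, fun n => Function.iterate_succ_apply' f n v, hmem, fun n => ?_⟩
  beta_reduce
  rw [Function.iterate_succ_apply']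
  exact (hf _ (hmem n)).1

/-- The edges that remain when the owner of `v` plays `s v` whenever `(owner v, v) ∈ W`. -/
def Committed (E : V → V → Prop) (owner : V → Agt) (W : Set (Agt × V)) (s : V → V) (v w : V) :
    Prop :=
  E v w ∧ ((owner v, v) ∈ W → w = s v)

/-- Player `i` wins every play from a vertex `v` with `(i, v) ∈ W` in the graph of the remaining
edges. -/
structure Commitment (E : V → V → Prop) (owner : V → Agt) (win : Agt → (ℕ → V) → Prop)
    (W : Set (Agt × V)) (s : V → V) : Prop where
  valid : ∀ v, (owner v, v) ∈ W → E v (s v)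
  wins : ∀ i π, (∀ n, Committed E owner W s (π n) (π (n + 1))) → (i, π 0) ∈ W → win i π

theorem Commitment.total {E : V → V → Prop} {owner : V → Agt} {win : Agt → (ℕ → V) → Prop}
    {W : Set (Agt × V)} {s : V → V} (h : Commitment E owner win W s) (hE : ∀ v, ∃ w, E v w)
    (v : V) : ∃ w, Committed E owner W s v w := by
  by_cases hv : (owner v, v) ∈ W
  · exact ⟨s v, h.valid v hv, fun _ => rfl⟩
  · obtain ⟨w, hw⟩ := hE v
    exact ⟨w, hw, fun h => absurd h hv⟩

theorem committed_mono {E : V → V → Prop} {owner : V → Agt} {W W' : Set (Agt × V)} {s s' : V → V}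
    (hW : W ⊆ W') (hs : ∀ v, (owner v, v) ∈ W → s' v = s v) {v w : V}
    (h : Committed E owner W' s' v w) : Committed E owner W s v w :=
  ⟨h.1, fun hv => (h.2 (hW hv)).trans (hs v hv)⟩

/-- The seed for the maximal commitment: one player commits on her own winning region. -/
theorem commitment_of_dominion {E : V → V → Prop} {owner : V → Agt} {win : Agt → (ℕ → V) → Prop}
    {i : Agt} {R : Set V} {s : V → V}
    (h : Dominion E (fun v => owner v = i) Set.univ ∅ (win i) R s) :
    Commitment E owner win {p | p.1 = i ∧ p.2 ∈ R} s := by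
  refine ⟨fun v hv => (h.move v hv.2 (by simp) hv.1).1, ?_⟩
  rintro j π hπ ⟨rfl, h0⟩
  have hs : ∀ n, π n ∈ R → owner (π n) = j → π (n + 1) = s (π n) :=
    fun n hn ho => (hπ n).2 ⟨ho, hn⟩
  have hmem := h.mem_of_mem (fun n => (hπ n).1) (by simp) (by simp) hs h0
  exact h.wins π (fun n => (hπ n).1) (fun n => hs n (hmem n)) fun n => ⟨hmem n, by simp⟩

/-- Every commitment extends to one for which the others win against player `i` in the graph of the
remaining edges, from every vertex at which `i` is not committed. -/
theorem exists_punishing_commitment {E : V → V → Prop} {owner : V → Agt}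
    (hE : ∀ v, ∃ w, E v w) (c : Agt → V → ℕ) (d : Agt → ℕ) (hc : ∀ i v, c i v < d i)
    {W₀ : Set (Agt × V)} {s₀ : V → V}
    (h₀ : Commitment E owner (fun i => ParityWin (c i) true) W₀ s₀) :
    ∃ W s, Commitment E owner (fun i => ParityWin (c i) true) W s ∧ W₀ ⊆ W ∧
      (∀ v, (owner v, v) ∈ W₀ → s v = s₀ v) ∧
      ∃ τ : Agt → V → V, ∀ i, Dominion (Committed E owner W s) (fun v => owner v ≠ i) Set.univ ∅
        (ParityWin (c i) false) {v | (i, v) ∉ W} (τ i) := by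
  suffices hchain : _ by
    obtain ⟨W, s, hW, hW₀, hs₀, hmax⟩ := exists_maximal_extension (fun v => (owner v, v))
      (Commitment E owner (fun i => ParityWin (c i) true)) hchain W₀ s₀ h₀
    refine ⟨W, s, hW, hW₀, hs₀, ?_⟩
    suffices hi : ∀ i, ∃ τ : V → V, Dominion (Committed E owner W s) (fun v => owner v ≠ i)
        Set.univ ∅ (ParityWin (c i) false) {v | (i, v) ∉ W} τ from
      ⟨fun i => (hi i).choose, fun i => (hi i).choose_spec⟩
    intro i
    obtain ⟨R, t, hcov, hdom⟩ := parity_determined (Committed E owner W s)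
      (fun v => decide (owner v = i)) (c i) (d i) Set.univ
      (fun v _ => by simpa using hW.total hE v) (fun v _ => hc i v)
    have hdt : Dominion (Committed E owner W s) (fun v => owner v = i) Set.univ ∅
        (ParityWin (c i) true) (R true) (t true) := by simpa using hdom true
    have hdf : Dominion (Committed E owner W s) (fun v => owner v ≠ i) Set.univ ∅
        (ParityWin (c i) false) (R false) (t false) := by simpa using hdom false
    -- Otherwise `i` could also commit to `t true` on `R true`, against maximality. Where `i` is
    -- already committed, `t true` agrees with `s`, as it uses only remaining edges.
    have hRW : ∀ v ∈ R true, (i, v) ∈ W := by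
      let s' : V → V := fun v =>
        if owner v = i ∧ v ∈ R true ∧ (i, v) ∉ W then t true v else s v
      have hs' : ∀ v, (owner v, v) ∈ W → s' v = s v := by
        intro v hv
        refine if_neg ?_
        rintro ⟨rfl, -, h⟩
        exact h hv
      have hsub : W ∪ {p | p.1 = i ∧ p.2 ∈ R true} ⊆ W := by
        refine hmax _ s' ⟨?_, ?_⟩ Set.subset_union_left hs'
        · intro v hv
          by_cases hvW : (owner v, v) ∈ W
          · rw [hs' v hvW]
            exact hW.valid v hvW
          · obtain ⟨ho, hvR⟩ := hv.resolve_left hvW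
            obtain rfl : owner v = i := ho
            have : s' v = t true v := if_pos ⟨rfl, hvR, hvW⟩
            rw [this]
            exact (hdt.move v hvR (by simp) rfl).1.1
        · intro j π hπ hj
          have hπ' : ∀ n, Committed E owner W s (π n) (π (n + 1)) := fun n =>
            committed_mono Set.subset_union_left hs' (hπ n)
          rcases hj with hj | ⟨hj, hj'⟩
          · exact hW.wins j π hπ' hj
          · obtain rfl : j = i := hj
            refine hdt.wins_of_mem (fun π k => (parityWin_shift _ _ π k).1) hπ' (by simp)
              (by simp) (fun n hn ho => ?_) (m := 0) hj'
            by_cases hvW : (j, π n) ∈ W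
            · have h1 := (hdt.move _ hn (by simp) ho).1.2
              rw [ho] at h1
              have h2 := (hπ' n).2
              rw [ho] at h2
              rw [h1 hvW, h2 hvW]
            · rw [(hπ n).2 (Or.inr ⟨ho, hn⟩)]
              exact if_pos ⟨ho, hn, hvW⟩
      exact fun v hv => hsub (Or.inr ⟨rfl, hv⟩)
    -- A play against `t false` within the remaining edges would be won and lost by `i`.
    have hWR : ∀ v, (i, v) ∈ W → v ∉ R false := by
      intro v hv hvR
      choose nx hnx using hW.total hE
      obtain ⟨π, h0, hstep, hmem, hEπ⟩ := exists_play (E := Committed E owner W s)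
        (f := fun v => if owner v ≠ i then t false v else nx v) (S := R false) (fun v hv => by
          by_cases ho : owner v = i
          · simp only [ho, ne_eq, not_true_eq_false, if_false]
            exact ⟨hnx v, hdf.closed v hv (by simp) (by simpa using ho) _ (by simp) (hnx v)⟩
          · simp only [ne_eq, ho, not_false_eq_true, if_true]
            exact hdf.move v hv (by simp) ho) hvR
      refine ParityWin.false_of_not (hW.wins i π hEπ (h0 ▸ hv)) (hdf.wins π hEπ (fun n ho => ?_)
        fun n => ⟨hmem n, by simp⟩)
      rw [hstep]
      exact if_pos ho
    have heq : R false = {v | (i, v) ∉ W} := by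
      ext v
      refine ⟨fun hv hvW => hWR v hvW hv, fun hv => ?_⟩
      exact (hcov v (by simp)).resolve_left fun h => hv (hRW v h)
    exact ⟨t false, heq ▸ hdf⟩
  intro C _ hC s hs
  refine ⟨?_, ?_⟩
  · rintro v ⟨p, hp, hv⟩
    rw [hs p hp v hv]
    exact (hC p hp).valid v hv
  · rintro i π hπ ⟨p, hp, hi⟩
    -- Larger commitments only delete edges, so the member of the chain that guarantees the win
    -- still does.
    have hsub : p.1 ⊆ {x | ∃ p ∈ C, x ∈ p.1} := fun x hx => ⟨p, hp, hx⟩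
    exact (hC p hp).wins i π (fun n => committed_mono hsub (hs p hp) (hπ n)) hi

end GraphGame

/-! ### Reduction of Muller conditions to parity conditions -/

namespace GraphGame

open Filter Classical

variable {α : Type*}

/-- The values of `x` after the last time before `n` at which the value `x n` was taken. -/
def sinceLast (x : ℕ → α) (n : ℕ) : Set α :=
  {q | ∃ m ≤ n, x m = q ∧ ∀ l, m ≤ l → l < n → x l ≠ x n}

/-- The latest appearance record priority for the Muller condition `F`. -/
noncomputable def priority (F : Set (Set α)) (x : ℕ → α) (n : ℕ) : ℕ :=
  2 * (sinceLast x n).ncard + if sinceLast x n ∈ F then 0 else 1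

/-- This makes the priority a function of the history read so far, hence a colour on the tree. -/
theorem priority_congr (F : Set (Set α)) {x y : ℕ → α} {n : ℕ} (h : ∀ m ≤ n, x m = y m) :
    priority F x n = priority F y n := by
  have : sinceLast x n = sinceLast y n := by
    ext q
    refine exists_congr fun m => and_congr_right fun hm => ?_
    rw [h m hm, h n le_rfl]
    refine and_congr_right fun _ => forall_congr' fun l => forall₂_congr fun _ hl => ?_
    rw [h l hl.le]
  unfold priority
  rw [this]

theorem priority_lt [Finite α] (F : Set (Set α)) (x : ℕ → α) (n : ℕ) :
    priority F x n < 2 * Nat.card α + 2 := by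
  have := Set.ncard_le_card (sinceLast x n)
  unfold priority
  split_ifs <;> omega

/-- From some time `N` on only recurrent values occur. Later still, the current value has already
occurred between `N` and now, so the window since that occurrence lies after `N`. -/
theorem eventually_sinceLast_subset [Finite α] (x : ℕ → α) :
    ∀ᶠ n in atTop, sinceLast x n ⊆ {q | ∃ᶠ n in atTop, x n = q} := by
  have h1 : ∀ᶠ n in atTop, ∀ q, (¬ ∃ᶠ n in atTop, x n = q) → x n ≠ q := by
    rw [eventually_all]
    intro q
    by_cases hq : ∃ᶠ n in atTop, x n = q
    · simp [hq]
    · simpa [hq] using not_frequently.1 hq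
  obtain ⟨N, hN⟩ := eventually_atTop.1 h1
  have h2 : ∀ᶠ n in atTop, ∀ q, (∃ᶠ n in atTop, x n = q) → ∃ l, N ≤ l ∧ l < n ∧ x l = q := by
    rw [eventually_all]
    intro q
    by_cases hq : ∃ᶠ n in atTop, x n = q
    · obtain ⟨l, hl, hlq⟩ := frequently_atTop.1 hq N
      filter_upwards [eventually_gt_atTop l] with n hn _
      exact ⟨l, hl, hn, hlq⟩
    · simp [hq]
  filter_upwards [h2, eventually_ge_atTop N] with n hn hnN
  rintro q ⟨m, hm, rfl, hlast⟩
  have hxn : ∃ᶠ k in atTop, x k = x n := by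
    by_contra h
    exact hN n hnN _ h rfl
  obtain ⟨l, hNl, hln, hl⟩ := hn _ hxn
  have hlm : l < m := by
    by_contra! h
    exact hlast l h hln hl
  by_contra h
  exact hN m (by omega) _ h rfl

/-- Look at the first occurrence after `N` of each recurrent value. At the latest of these times the
current value has not been seen since `N`, so the window contains all the others. -/
theorem frequently_subset_sinceLast [Finite α] (x : ℕ → α) :
    ∃ᶠ n in atTop, {q | ∃ᶠ n in atTop, x n = q} ⊆ sinceLast x n := by
  rw [frequently_atTop]
  intro N
  have hex : ∀ q ∈ {q | ∃ᶠ n in atTop, x n = q}, ∃ n, N ≤ n ∧ x n = q := fun q hq =>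
    frequently_atTop.1 hq N
  let f : α → ℕ := fun q => if h : ∃ n, N ≤ n ∧ x n = q then Nat.find h else 0
  have hf : ∀ q ∈ {q | ∃ᶠ n in atTop, x n = q}, (N ≤ f q ∧ x (f q) = q) ∧
      ∀ l, N ≤ l → l < f q → x l ≠ q := by
    intro q hq
    have hfq : f q = Nat.find (hex q hq) := dif_pos (hex q hq)
    rw [hfq]
    exact ⟨Nat.find_spec (hex q hq), fun l hl hlt heq => Nat.find_min (hex q hq) hlt ⟨hl, heq⟩⟩
  rcases Set.eq_empty_or_nonempty {q | ∃ᶠ n in atTop, x n = q} with he | hne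
  · exact ⟨N, le_rfl, by simp [he]⟩
  obtain ⟨q, hq, hmax⟩ := Set.exists_max_image _ f (Set.toFinite _) hne
  refine ⟨f q, (hf q hq).1.1, fun q' hq' => ⟨f q', hmax q' hq', (hf q' hq').1.2, fun l hl hlt => ?_⟩⟩
  rw [(hf q hq).1.2]
  exact (hf q hq).2 l ((hf q' hq').1.1.trans hl) hlt

/-- The windows are eventually contained in the set of recurrent values and infinitely often equal
to it. The factor 2 lets a proper subset have smaller priority whatever its parity bit. -/
theorem limsupEq_priority [Finite α] (F : Set (Set α)) (x : ℕ → α) :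
    LimsupEq (priority F x) (2 * {q | ∃ᶠ n in atTop, x n = q}.ncard +
      if {q | ∃ᶠ n in atTop, x n = q} ∈ F then 0 else 1) := by
  refine ⟨?_, ?_⟩
  · refine ((frequently_subset_sinceLast x).and_eventually
      (eventually_sinceLast_subset x)).mono fun n hn => ?_
    unfold priority
    rw [hn.2.antisymm hn.1]
  · filter_upwards [eventually_sinceLast_subset x] with n hn
    rcases eq_or_ne (sinceLast x n) {q | ∃ᶠ n in atTop, x n = q} with he | he
    · unfold priority
      rw [he]
    · have := Set.ncard_lt_ncard (hn.ssubset_of_ne he)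
      unfold priority
      split_ifs <;> omega

/-- The times themselves serve as vertices, coloured by their priority, and the play is `id`. -/
theorem parityWin_priority_iff [Finite α] (F : Set (Set α)) (x : ℕ → α) (b : Bool) :
    ParityWin (priority F x) b id ↔ ({q | ∃ᶠ n in atTop, x n = q} ∈ F ↔ b = true) := by
  have h := limsupEq_priority F x
  constructor
  · rintro ⟨k, hk, hkb⟩
    rw [← hkb, hk.unique h]
    split_ifs with hF <;> simp [hF, parity_simps]
  · intro hb
    refine ⟨_, h, ?_⟩
    rw [← hb]
    split_ifs with hF <;> simp [hF, parity_simps]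

end GraphGame

/-! ### Runs and outcomes -/

namespace Arena

open Filter Classical GraphGame

variable {Agt : Type u} (A : Arena.{u, v, w} Agt)

@[simp]
theorem length_hist (ρ : ℕ → A.Step) (n : ℕ) : (A.hist ρ n).length = n := by
  simp [hist]

@[simp]
theorem hist_zero (ρ : ℕ → A.Step) : A.hist ρ 0 = [] := rfl

theorem hist_succ (ρ : ℕ → A.Step) (n : ℕ) : A.hist ρ (n + 1) = A.hist ρ n ++ [ρ n] := by
  simp [hist, List.range_succ]

theorem hist_eq_iff {ρ ρ' : ℕ → A.Step} {n : ℕ} :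
    A.hist ρ n = A.hist ρ' n ↔ ∀ m < n, ρ m = ρ' m := by
  simp [hist, List.map_inj_left]

theorem take_hist (ρ : ℕ → A.Step) {m n : ℕ} (h : m ≤ n) :
    (A.hist ρ n).take m = A.hist ρ m := by
  rw [hist, hist, ← List.map_take, List.take_range, min_eq_left h]

theorem hist_eq_of_le {ρ ρ' : ℕ → A.Step} {m n : ℕ} (h : A.hist ρ n = A.hist ρ' n) (hmn : m ≤ n) :
    A.hist ρ m = A.hist ρ' m := by
  rw [← A.take_hist ρ hmn, h, A.take_hist ρ' hmn]

theorem state_eq_of_hist_eq {ρ ρ' : ℕ → A.Step} (hρ : A.IsRun ρ) (hρ' : A.IsRun ρ')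
    (h0 : (ρ 0).1 = (ρ' 0).1) {n : ℕ} (h : A.hist ρ n = A.hist ρ' n) : (ρ n).1 = (ρ' n).1 := by
  cases n with
  | zero => exact h0
  | succ n =>
    rw [← hρ n, ← hρ' n, A.hist_eq_iff.1 h n (Nat.lt_succ_self n)]

theorem exists_first_difference {ρ ρ' : ℕ → A.Step} (hρ : A.IsRun ρ) (hρ' : A.IsRun ρ')
    (h0 : (ρ 0).1 = (ρ' 0).1) (hne : ρ ≠ ρ') :
    ∃ n, A.hist ρ n = A.hist ρ' n ∧ (ρ n).1 = (ρ' n).1 ∧ ρ n ≠ ρ' n := by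
  have hex : ∃ n, ρ n ≠ ρ' n := by
    by_contra! h
    exact hne (funext h)
  have hh : A.hist ρ (Nat.find hex) = A.hist ρ' (Nat.find hex) :=
    A.hist_eq_iff.2 fun m hm => not_not.1 (Nat.find_min hex hm)
  exact ⟨_, hh, A.state_eq_of_hist_eq hρ hρ' h0 hh, Nat.find_spec hex⟩

/-- The step that the profile `σ` prescribes after the history `h`, `s`. -/
def move (σ : A.Profile) (h : List A.Step) (s : A.State) : A.Step := ⟨s, σ s.1 h s.2⟩

theorem mem_outcomes_iff {s : A.State} {P : Set Agt} {σ : A.Profile} {ρ : ℕ → A.Step} :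
    ρ ∈ A.outcomes s P σ ↔ A.IsRun ρ ∧ (ρ 0).1 = s ∧
      ∀ n, (ρ n).1.1 ∈ P → ρ n = A.move σ (A.hist ρ n) (ρ n).1 := by
  refine and_congr_right fun _ => and_congr_right fun _ => ⟨fun h n hn => ?_, fun h i hi n x hx => ?_⟩
  · exact h _ hn n (ρ n).1.2 rfl
  · have := h n (by rw [hx]; exact hi)
    rw [hx] at this
    exact this

/-- Strategies have types depending on the owner of the state. Giving whole steps as a function of
the history avoids transports. -/
theorem exists_profile (F : List A.Step → A.State → A.Step) (hF : ∀ h s, (F h s).1 = s) :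
    ∃ σ : A.Profile, ∀ h s, A.move σ h s = F h s := by
  have : ∀ h s, ∃ a : A.Act s.1, (⟨s, a⟩ : A.Step) = F h s := fun h s => by
    have := hF h s
    generalize F h s = st at this
    subst this
    exact ⟨st.2, rfl⟩
  choose g hg using this
  exact ⟨fun i h x => g h ⟨i, x⟩, hg⟩

theorem move_update [DecidableEq Agt] (σ T : A.Profile) (i : Agt) (h : List A.Step)
    (s : A.State) :
    A.move (Function.update σ i (T i)) h s = if s.1 = i then A.move T h s else A.move σ h s := by
  obtain ⟨j, x⟩ := s
  by_cases hj : j = i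
  · subst hj
    simp [move]
  · simp [move, hj]

/-- The history after `n` steps from `s` with the profile `σ`. -/
def path (σ : A.Profile) (s : A.State) : ℕ → List A.Step × A.State
  | 0 => ([], s)
  | n + 1 => ((path σ s n).1 ++ [A.move σ (path σ s n).1 (path σ s n).2],
      A.δ (path σ s n).2 (A.move σ (path σ s n).1 (path σ s n).2).2)

/-- The outcome of the profile `σ` from `s`. -/
def play (σ : A.Profile) (s : A.State) (n : ℕ) : A.Step :=
  A.move σ (A.path σ s n).1 (A.path σ s n).2

theorem hist_play (σ : A.Profile) (s : A.State) (n : ℕ) :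
    A.hist (A.play σ s) n = (A.path σ s n).1 := by
  induction n with
  | zero => rfl
  | succ n ih =>
    rw [hist_succ, ih]
    rfl

theorem play_mem_outcomes (σ : A.Profile) (s : A.State) (P : Set Agt) :
    A.play σ s ∈ A.outcomes s P σ := by
  refine A.mem_outcomes_iff.2 ⟨fun n => rfl, rfl, fun n _ => ?_⟩
  rw [hist_play]
  rfl

theorem isRun_play (σ : A.Profile) (s : A.State) : A.IsRun (A.play σ s) :=
  (A.play_mem_outcomes σ s Set.univ).1

theorem play_eq_move (σ : A.Profile) (s : A.State) (n : ℕ) :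
    A.play σ s n = A.move σ (A.hist (A.play σ s) n) (A.play σ s n).1 :=
  (A.mem_outcomes_iff.1 (A.play_mem_outcomes σ s Set.univ)).2.2 n trivial

theorem eq_play {σ : A.Profile} {s : A.State} {ρ : ℕ → A.Step}
    (h : A.IsRun ρ) (h0 : (ρ 0).1 = s) (hσ : ∀ n, ρ n = A.move σ (A.hist ρ n) (ρ n).1) :
    ρ = A.play σ s := by
  by_contra hne
  obtain ⟨n, h1, h2, h3⟩ := A.exists_first_difference h (A.isRun_play σ s) h0 hne
  apply h3
  rw [hσ n, A.play_eq_move, ← h1, ← h2]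

theorem outcomes_univ (σ : A.Profile) (s : A.State) :
    A.outcomes s Set.univ σ = {A.play σ s} := by
  ext ρ
  constructor
  · intro h
    have := A.mem_outcomes_iff.1 h
    exact A.eq_play this.1 this.2.1 fun n => this.2.2 n trivial
  · rintro rfl
    exact A.play_mem_outcomes σ s _

/-! ### The tree of histories -/

/-- The history after `h` and the step `t`. -/
def next (h : List A.Step) (t : A.Step) : List A.Step × A.State := (h ++ [t], A.δ t.1 t.2)

/-- The edges of the tree of histories. -/
def Edge (v w : List A.Step × A.State) : Prop := ∃ t : A.Step, t.1 = v.2 ∧ w = A.next v.1 t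

/-- The history that consists of `h` and the first `n` steps of `ρ`. -/
def vert (h : List A.Step) (ρ : ℕ → A.Step) (n : ℕ) : List A.Step × A.State :=
  (h ++ A.hist ρ n, (ρ n).1)

theorem vert_succ {ρ : ℕ → A.Step} (hρ : A.IsRun ρ) (h : List A.Step) (n : ℕ) :
    A.vert h ρ (n + 1) = A.next (h ++ A.hist ρ n) (ρ n) := by
  simp [vert, next, hist_succ, hρ n]

theorem edge_vert {ρ : ℕ → A.Step} (hρ : A.IsRun ρ) (h : List A.Step) (n : ℕ) :
    A.Edge (A.vert h ρ n) (A.vert h ρ (n + 1)) :=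
  ⟨ρ n, rfl, A.vert_succ hρ h n⟩

theorem glue_hist (ρ₀ ρ : ℕ → A.Step) (m n : ℕ) :
    A.glue (A.hist ρ₀ m) ρ n = if n < m then ρ₀ n else ρ (n - m) := by
  unfold glue
  split_ifs with h
  · rw [List.getD_eq_getElem _ _ (by simpa using h)]
    simp [hist]
  · rw [List.getD_eq_default _ _ (by simpa using h)]
    simp

theorem glue_add (h : List A.Step) (ρ : ℕ → A.Step) (n : ℕ) :
    A.glue h ρ (n + h.length) = ρ n := by
  unfold glue
  rw [List.getD_eq_default _ _ (by omega), Nat.add_sub_cancel]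

theorem glue_nil (ρ : ℕ → A.Step) : A.glue [] ρ = ρ := by
  ext1 n
  simp [glue]

theorem residual_nil (φ : Set (ℕ → A.Step)) : A.residual [] φ = φ := by
  ext ρ
  simp [residual, glue_nil]

theorem isRun_glue {h : List A.Step} {s : A.State} (hh : A.IsHistory h s) {ρ : ℕ → A.Step}
    (hρ : A.IsRun ρ) (h0 : (ρ 0).1 = s) : A.IsRun (A.glue h ρ) := by
  obtain ⟨ρ₀, hρ₀, he, hs⟩ := hh
  rw [he]
  intro n
  rw [glue_hist, glue_hist]
  rcases lt_trichotomy (n + 1) h.length with hl | hl | hl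
  · rw [if_pos (by omega), if_pos hl]
    exact hρ₀ n
  · rw [if_pos (by omega), if_neg (by omega), hl, Nat.sub_self, h0, ← hs, ← hl]
    exact hρ₀ n
  · rw [if_neg (by omega), if_neg (by omega), Nat.sub_add_comm (by omega)]
    exact hρ _

theorem hist_glue {h : List A.Step} {s : A.State} (hh : A.IsHistory h s) (ρ : ℕ → A.Step) (n : ℕ) :
    A.hist (A.glue h ρ) (n + h.length) = h ++ A.hist ρ n := by
  induction n with
  | zero =>
    obtain ⟨ρ₀, hρ₀, he, hs⟩ := hh
    rw [zero_add, hist_zero, List.append_nil]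
    conv_rhs => rw [he]
    refine A.hist_eq_iff.2 fun m hm => ?_
    rw [he, glue_hist, if_pos hm]
  | succ n ih =>
    rw [Nat.add_right_comm, hist_succ, ih, hist_succ, glue_add, List.append_assoc]

theorem isHistory_nil {ρ : ℕ → A.Step} (hρ : A.IsRun ρ) : A.IsHistory [] (ρ 0).1 :=
  ⟨ρ, hρ, rfl, rfl⟩

/-- An ω-regular objective is a parity condition on the tree of histories. -/
theorem IsOmegaRegular.exists_color {φ : Set (ℕ → A.Step)} (hφ : A.IsOmegaRegular φ) :
    ∃ (c : List A.Step × A.State → ℕ) (d : ℕ), (∀ v, c v < d) ∧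
      ∀ h s ρ, A.IsHistory h s → A.IsRun ρ → (ρ 0).1 = s → ∀ b : Bool,
        (ParityWin c b (A.vert h ρ) ↔ (ρ ∈ A.residual h φ ↔ b = true)) := by
  obtain ⟨k, q₀, step, F, hF⟩ := hφ
  -- The automaton is run on the whole history from the root, so one colouring serves all residual
  -- objectives at once; the prefix `h` is then a mere shift.
  refine ⟨fun v => priority F (fun m => (v.1.take m).foldl step q₀) v.1.length,
    2 * Nat.card (Fin k) + 2, fun v => priority_lt _ _ _, fun h s ρ hh hρ h0 b => ?_⟩
  have hr := A.isRun_glue hh hρ h0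
  have hmem : ρ ∈ A.residual h φ ↔ _ := hF _ hr
  rw [hmem, ← parityWin_priority_iff, ← parityWin_shift _ _ id h.length]
  refine exists_congr fun l => and_congr_left fun _ => ?_
  refine iff_of_eq (congrArg (LimsupEq · l) (funext fun n => ?_))
  have hl : (A.vert h ρ n).1 = A.hist (A.glue h ρ) (n + h.length) := (A.hist_glue hh ρ n).symm
  simp only [hl, length_hist, id]
  refine priority_congr F fun m hm => ?_
  rw [A.take_hist _ hm]

theorem IsOmegaRegular.exists_color_init {φ : Set (ℕ → A.Step)} (hφ : A.IsOmegaRegular φ) :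
    ∃ (c : List A.Step × A.State → ℕ) (d : ℕ), (∀ v, c v < d) ∧
      ∀ ρ, A.IsRun ρ → ∀ b : Bool, (ParityWin c b (A.vert [] ρ) ↔ (ρ ∈ φ ↔ b = true)) := by
  obtain ⟨c, d, hc, h⟩ := IsOmegaRegular.exists_color A hφ
  refine ⟨c, d, hc, fun ρ hρ b => ?_⟩
  rw [h [] _ ρ (A.isHistory_nil hρ) hρ rfl, residual_nil]

end Arena

/-! ### Subgame perfect equilibria -/

namespace Arena

open Filter Classical GraphGame

variable {Agt : Type u} (A : Arena.{u, v, w} Agt)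

/-- Converts a positional strategy on the tree into a profile, with `σ` as default off `S`. -/
theorem exists_profile_of_strategy {S : Set (List A.Step × A.State)}
    {t : List A.Step × A.State → List A.Step × A.State} (ht : ∀ v ∈ S, A.Edge v (t v))
    (σ : A.Profile) :
    ∃ σ' : A.Profile, (∀ v ∈ S, A.next v.1 (A.move σ' v.1 v.2) = t v) ∧
      ∀ v ∉ S, A.move σ' v.1 v.2 = A.move σ v.1 v.2 := by
  have : Nonempty A.Step := ⟨A.move σ [] A.init⟩
  choose! st hst using ht
  obtain ⟨σ', hσ'⟩ := A.exists_profile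
    (fun h s => if (h, s) ∈ S then st (h, s) else A.move σ h s) (fun h s => by
      by_cases hS : (h, s) ∈ S
      · simpa only [hS, if_true] using (hst _ hS).1
      · simp only [hS, if_false]
        rfl)
  refine ⟨σ', fun v hv => ?_, fun v hv => ?_⟩
  · rw [hσ', if_pos hv]
    exact (hst v hv).2.symm
  · rw [hσ', if_neg hv]

theorem move_update_of_ne [DecidableEq Agt] (σ : A.Profile) {i : Agt} (τ : A.Strategy i)
    (h : List A.Step) {s : A.State} (hs : s.1 ≠ i) :
    A.move (Function.update σ i τ) h s = A.move σ h s := by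
  simp [move, hs]

/-- The last player who deviated from `f`, for a history in reverse order. -/
noncomputable def lastDeviatorRev (f : Option Agt → List A.Step × A.State → A.Step) :
    List A.Step → Option Agt
  | [] => none
  | t :: r => if t = f (lastDeviatorRev f r) (r.reverse, t.1) then lastDeviatorRev f r
      else some t.1.1

/-- The last player who deviated from the steps given by `f`, which themselves depend on the player
who deviated last. -/
noncomputable def lastDeviator (f : Option Agt → List A.Step × A.State → A.Step)
    (h : List A.Step) : Option Agt :=
  A.lastDeviatorRev f h.reverse

theorem lastDeviator_concat (f : Option Agt → List A.Step × A.State → A.Step) (h : List A.Step)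
    (t : A.Step) : A.lastDeviator f (h ++ [t]) =
      if t = f (A.lastDeviator f h) (h, t.1) then A.lastDeviator f h else some t.1.1 := by
  simp only [lastDeviator, List.reverse_append, List.reverse_singleton, List.singleton_append,
    lastDeviatorRev, List.reverse_reverse]
  congr

theorem edge_total (hne : ∀ s : A.State, Nonempty (A.Act s.1)) (v : List A.Step × A.State) :
    ∃ w, A.Edge v w :=
  ⟨_, ⟨v.2, (hne v.2).some⟩, rfl, rfl⟩

end Arena

namespace ArenaGame

open Filter Classical GraphGame

variable {Agt : Type u} (G : ArenaGame.{u, v, w} Agt)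

/-- A game with ω-regular objectives has a subgame perfect equilibrium in which player `i` uses a
winning strategy if there is one. -/
theorem exists_subgamePerfect [DecidableEq Agt] (hG : G.OmegaRegular)
    (hne : ∀ s : G.State, Nonempty (G.Act s.1)) (sys : Agt) :
    ∃ σ : G.Profile, (∀ h s, G.IsHistory h s →
      G.NashFrom s (fun i => G.residual h (G.obj i)) Set.univ (G.shift σ h)) ∧
      ((∃ σ' : G.Profile, G.Models {sys} σ' (G.obj sys)) → G.Models {sys} σ (G.obj sys)) := by
  choose c d hc hwin using fun i => Arena.IsOmegaRegular.exists_color G.toArena (hG i)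
  have hE := G.toArena.edge_total hne
  have htail : ∀ i b (π : ℕ → List G.Step × G.State) k,
      ParityWin (c i) b (fun n => π (n + k)) → ParityWin (c i) b π :=
    fun i b π k => (parityWin_shift (c i) b π k).1
  let owner : List G.Step × G.State → Agt := fun v => v.2.1
  obtain ⟨R, t, hcov, hdom⟩ := parity_determined G.toArena.Edge
      (fun v => decide (owner v = sys)) (c sys) (d sys) Set.univ
      (fun v _ => by simpa using hE v) (fun v _ => hc sys v)
  have hdt : Dominion G.toArena.Edge (fun v => owner v = sys) Set.univ ∅
      (ParityWin (c sys) true) (R true) (t true) := by simpa using hdom true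
  have hdf : Dominion G.toArena.Edge (fun v => owner v ≠ sys) Set.univ ∅
      (ParityWin (c sys) false) (R false) (t false) := by simpa using hdom false
  obtain ⟨W, s, hW, hW₀, hs₀, τ, hτ⟩ := exists_punishing_commitment hE c d hc
    (commitment_of_dominion (win := fun i => ParityWin (c i) true) hdt)
  -- Every prescribed step respects the commitments; where the last deviator `p` is neither moving
  -- nor sure to win, it is also the punishing step.
  have hf : ∀ (p : Option Agt) (v : List G.Step × G.State), ∃ st : G.Step, st.1 = v.2 ∧
      Committed G.toArena.Edge owner W s v (G.toArena.next v.1 st) ∧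
      ∀ i, p = some i → owner v ≠ i → (i, v) ∉ W → G.toArena.next v.1 st = τ i v := by
    intro p v
    by_cases hex : ∃ i, p = some i ∧ owner v ≠ i ∧ (i, v) ∉ W
    · obtain ⟨i, rfl, ho, hv⟩ := hex
      have h1 := ((hτ i).move v hv (by simp) ho).1
      obtain ⟨st, hst, he⟩ := h1.1
      refine ⟨st, hst, he ▸ h1, fun j hj _ _ => ?_⟩
      obtain rfl := Option.some_injective _ hj
      exact he.symm
    · obtain ⟨w, hw⟩ := hW.total hE v
      obtain ⟨st, hst, he⟩ := hw.1
      exact ⟨st, hst, he ▸ hw, fun i h1 h2 h3 => absurd ⟨i, h1, h2, h3⟩ hex⟩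
  choose f hf1 hf2 hf3 using hf
  obtain ⟨σ, hσ⟩ := G.toArena.exists_profile
    (fun h s => f (G.toArena.lastDeviator f h) (h, s)) (fun h s => hf1 _ _)
  refine ⟨σ, fun h s₀ hh i _ T hT => ?_, ?_⟩
  · rw [Arena.outcomes_univ, Set.singleton_subset_iff] at hT ⊢
    set ρ' := G.toArena.play (Function.update (G.shift σ h) i T) s₀ with hρ'
    set ρ := G.toArena.play (G.shift σ h) s₀ with hρ
    have hrun : G.IsRun ρ := G.toArena.isRun_play _ _
    have hrun' : G.IsRun ρ' := G.toArena.isRun_play _ _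
    by_contra hlose
    have hstep : ∀ n, ρ n = f (G.toArena.lastDeviator f (h ++ G.hist ρ n)) (G.toArena.vert h ρ n) := by
      intro n
      rw [hρ, G.toArena.play_eq_move, ← hρ]
      exact hσ (h ++ G.hist ρ n) (ρ n).1
    have hcom : ∀ n, Committed G.toArena.Edge owner W s (G.toArena.vert h ρ n)
        (G.toArena.vert h ρ (n + 1)) := by
      intro n
      rw [G.toArena.vert_succ hrun, hstep n]
      exact hf2 _ _
    -- All players respect the commitments along `ρ`, so meeting `W` would make `i` win.
    have hnW : ∀ n, (i, G.toArena.vert h ρ n) ∉ W := by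
      intro n hn
      refine hlose (((hwin i h s₀ ρ hh hrun rfl true).1 (htail i true _ n
        (hW.wins i (fun m => G.toArena.vert h ρ (m + n)) (fun m => ?_) ?_))).2 rfl)
      · rw [Nat.add_right_comm]
        exact hcom _
      · simpa using hn
    have hothers : ∀ n, (ρ' n).1.1 ≠ i →
        ρ' n = f (G.toArena.lastDeviator f (h ++ G.hist ρ' n)) (G.toArena.vert h ρ' n) := by
      intro n hn
      have := G.toArena.play_eq_move (Function.update (G.shift σ h) i T) s₀ n
      rw [← hρ', G.toArena.move_update_of_ne _ _ _ hn] at this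
      exact this.trans (hσ (h ++ G.hist ρ' n) (ρ' n).1)
    obtain ⟨N, hN1, hN2, hN3⟩ := G.toArena.exists_first_difference hrun hrun' rfl
      (fun e => hlose (e ▸ hT))
    have hvN : G.toArena.vert h ρ' N = G.toArena.vert h ρ N := by
      simp only [Arena.vert, hN1, hN2]
    have hoN : (ρ' N).1.1 = i := by
      by_contra ho
      exact hN3 (by rw [hothers N ho, hstep N, hvN, hN1])
    have hown : ∀ n, (i, G.toArena.vert h ρ' n) ∉ W → (ρ' n).1.1 = i →
        Committed G.toArena.Edge owner W s (G.toArena.vert h ρ' n) (G.toArena.vert h ρ' (n + 1)) := by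
      intro n hn ho
      refine ⟨G.toArena.edge_vert hrun' h n, fun h' => absurd h' ?_⟩
      have : owner (G.toArena.vert h ρ' n) = i := ho
      rwa [this]
    have hoth : ∀ n, (i, G.toArena.vert h ρ' n) ∉ W → (ρ' n).1.1 ≠ i →
        G.toArena.lastDeviator f (h ++ G.hist ρ' n) = some i →
        G.toArena.vert h ρ' (n + 1) = τ i (G.toArena.vert h ρ' n) := by
      intro n hn ho hd
      rw [G.toArena.vert_succ hrun', hothers n ho, hd]
      exact hf3 (some i) (G.toArena.vert h ρ' n) i rfl ho hn
    -- The first difference is a deviation of `i`. Afterwards the others follow `f`, so `i` remains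
    -- the last deviator whether or not she deviates again, and punishment keeps the play outside
    -- her part of `W`.
    have hinv : ∀ m, G.toArena.lastDeviator f (h ++ G.hist ρ' (m + (N + 1))) = some i ∧
        (i, G.toArena.vert h ρ' (m + (N + 1))) ∉ W := by
      intro m
      induction m with
      | zero =>
        rw [zero_add]
        constructor
        · rw [Arena.hist_succ, ← List.append_assoc, Arena.lastDeviator_concat, if_neg, hoN]
          intro e
          refine hN3 (((hstep N).trans ?_).trans e.symm)
          rw [hN1, ← hvN]
          rfl
        · exact (hτ i).closed (G.toArena.vert h ρ' N) (by rw [hvN]; exact hnW N) (by simp)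
            (not_not.2 hoN) _ (by simp) (hown N (by rw [hvN]; exact hnW N) hoN)
      | succ m ih =>
        rw [Nat.add_right_comm]
        by_cases ho : (ρ' (m + (N + 1))).1.1 = i
        · constructor
          · rw [Arena.hist_succ, ← List.append_assoc, Arena.lastDeviator_concat, ho, ih.1]
            simp
          · exact (hτ i).closed _ ih.2 (by simp) (not_not.2 ho) _ (by simp) (hown _ ih.2 ho)
        · constructor
          · rw [Arena.hist_succ, ← List.append_assoc, Arena.lastDeviator_concat, if_pos, ih.1]
            exact hothers _ ho
          · rw [hoth _ ih.2 ho ih.1]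
            exact ((hτ i).move _ ih.2 (by simp) ho).2
    have hl : ParityWin (c i) false (G.toArena.vert h ρ') := by
      refine htail i false _ (N + 1) ((hτ i).wins _ (fun m => ?_) (fun m ho => ?_)
        fun m => ⟨(hinv m).2, by simp⟩)
      · rw [Nat.add_right_comm]
        by_cases ho : (ρ' (m + (N + 1))).1.1 = i
        · exact hown _ (hinv m).2 ho
        · rw [hoth _ (hinv m).2 ho (hinv m).1]
          exact ((hτ i).move _ (hinv m).2 (by simp) ho).1
      · rw [Nat.add_right_comm]
        exact hoth _ (hinv m).2 ho (hinv m).1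
    exact absurd ((hwin i h s₀ ρ' hh hrun' rfl false).1 hl |>.1 hT) (by simp)
  · rintro ⟨σ', hσ'⟩ ρ hρ
    rw [Arena.mem_outcomes_iff] at hρ
    obtain ⟨hrun, h0, hcomp⟩ := hρ
    -- Otherwise the others could play `t false` against `σ'` and make `sys` lose.
    have hinit : (([], G.init) : List G.Step × G.State) ∈ R true := by
      refine (hcov _ (by simp)).resolve_right fun hf => ?_
      obtain ⟨T, hT1, hT2⟩ := G.toArena.exists_profile_of_strategy
        (S := {v | v ∈ R false ∧ owner v ≠ sys}) (t := t false)
        (fun v hv => (hdf.move v hv.1 (by simp) hv.2).1) σ'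
      set r := G.toArena.play T G.init with hr
      have hrrun : G.IsRun r := G.toArena.isRun_play _ _
      have hmem : r ∈ G.outcomes G.init {sys} σ' := by
        refine G.toArena.mem_outcomes_iff.2 ⟨hrrun, rfl, fun n hn => ?_⟩
        rw [hr, G.toArena.play_eq_move, ← hr]
        exact hT2 (G.hist r n, (r n).1) fun h => h.2 hn
      have hlose : ParityWin (c sys) false (G.toArena.vert [] r) := by
        refine hdf.wins_of_mem (htail sys false) (fun n => G.toArena.edge_vert hrrun [] n)
          (by simp) (by simp) (fun n hn ho => ?_) (m := 0) hf
        rw [← hT1 _ ⟨hn, ho⟩, G.toArena.vert_succ hrrun]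
        congr 1
        exact G.toArena.play_eq_move T G.init n
      have := (hwin sys [] _ r (G.toArena.isHistory_nil hrrun) hrrun rfl false).1 hlose
      rw [Arena.residual_nil] at this
      exact absurd (this.1 (hσ' hmem)) (by simp)
    have hw : ParityWin (c sys) true (G.toArena.vert [] ρ) := by
      refine hdt.wins_of_mem (htail sys true) (fun n => G.toArena.edge_vert hrun [] n)
        (by simp) (by simp) (fun n hn ho => ?_) (m := 0) (by simpa [Arena.vert, h0] using hinit)
      have hvW : (owner (G.toArena.vert [] ρ n), G.toArena.vert [] ρ n) ∈
          {p : Agt × (List G.Step × G.State) | p.1 = sys ∧ p.2 ∈ R true} := ⟨ho, hn⟩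
      rw [← hs₀ _ hvW, G.toArena.vert_succ hrun, hcomp n ho, hσ]
      exact (hf2 _ (G.toArena.vert [] ρ n)).2 (hW₀ hvW)
    have := (hwin sys [] _ ρ (G.toArena.isHistory_nil hrun) hrun rfl true).1 hw
    rw [Arena.residual_nil] at this
    exact this.2 rfl

end ArenaGame

/-! ### Admissible strategies -/

namespace GraphGame

open Classical

/-- Playing both strategies against each other from a common vertex gives a play won by both sides.
-/
theorem Dominion.notMem_of_mem {V : Type*} {E : V → V → Prop} {own : V → Prop} {c : V → ℕ}
    {R Q : Set V} {s t : V → V}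
    (hR : Dominion E own Set.univ ∅ (ParityWin c true) R s)
    (hQ : Dominion E (fun v => ¬ own v) Set.univ ∅ (ParityWin c false) Q t) {v : V} (hv : v ∈ R) :
    v ∉ Q := by
  intro hvQ
  obtain ⟨π, -, hstep, hmem, hE⟩ := exists_play (E := E) (S := R ∩ Q)
    (f := fun v => if own v then s v else t v) (fun v hv => by
      by_cases ho : own v
      · simp only [ho, if_true]
        have := hR.move v hv.1 (by simp) ho
        exact ⟨this.1, this.2, hQ.closed v hv.2 (by simp) (not_not.2 ho) _ (by simp) this.1⟩
      · simp only [ho, if_false]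
        have := hQ.move v hv.2 (by simp) ho
        exact ⟨this.1, hR.closed v hv.1 (by simp) ho _ (by simp) this.1, this.2⟩) ⟨hv, hvQ⟩
  refine ParityWin.false_of_not
    (hR.wins π hE (fun n ho => ?_) fun n => ⟨(hmem n).1, by simp⟩)
    (hQ.wins π hE (fun n ho => ?_) fun n => ⟨(hmem n).2, by simp⟩)
  · rw [hstep, if_pos ho]
  · rw [hstep, if_neg ho]

end GraphGame

namespace Arena

open Filter Classical GraphGame

variable {Agt : Type u} (A : Arena.{u, v, w} Agt)

theorem getElem?_hist (ρ : ℕ → A.Step) (m n : ℕ) :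
    (A.hist ρ n)[m]? = if m < n then some (ρ m) else none := by
  simp only [hist, List.getElem?_map]
  split_ifs with h
  · rw [List.getElem?_range h]
    rfl
  · rw [List.getElem?_eq_none (by simpa using h)]
    rfl

theorem vert_eq_of_hist_eq {ρ ρ' : ℕ → A.Step} (hρ : A.IsRun ρ) (hρ' : A.IsRun ρ')
    (h0 : (ρ 0).1 = (ρ' 0).1) {n : ℕ} (h : A.hist ρ n = A.hist ρ' n) :
    A.vert [] ρ n = A.vert [] ρ' n := by
  simp only [vert, h, A.state_eq_of_hist_eq hρ hρ' h0 h]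

theorem hist_eq_of_forall_step {ρ ρ' : ℕ → A.Step} (hρ : A.IsRun ρ) (hρ' : A.IsRun ρ')
    (h0 : (ρ 0).1 = (ρ' 0).1) {n : ℕ}
    (h : ∀ j < n, A.hist ρ j = A.hist ρ' j → (ρ j).1 = (ρ' j).1 → ρ j = ρ' j) :
    A.hist ρ n = A.hist ρ' n := by
  induction n with
  | zero => rfl
  | succ n ih =>
    have hn := ih fun j hj => h j (by omega)
    rw [hist_succ, hist_succ, hn,
      h n (Nat.lt_succ_self n) hn (A.state_eq_of_hist_eq hρ hρ' h0 hn)]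

theorem play_congr {σ σ' : A.Profile} {s : A.State}
    (h : ∀ n, A.move σ (A.hist (A.play σ s) n) (A.play σ s n).1 =
      A.move σ' (A.hist (A.play σ s) n) (A.play σ s n).1) : A.play σ s = A.play σ' s :=
  A.eq_play (A.isRun_play σ s) rfl fun n => (A.play_eq_move σ s n).trans (h n)

theorem play_update_eq_of_eq [DecidableEq Agt] {σ T : A.Profile} {i : Agt} {s : A.State} {n : ℕ}
    (hn : (A.play (Function.update σ i (T i)) s n).1.1 = i) :
    A.play (Function.update σ i (T i)) s n =
      A.move T (A.hist (A.play (Function.update σ i (T i)) s) n)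
        (A.play (Function.update σ i (T i)) s n).1 := by
  have := A.play_eq_move (Function.update σ i (T i)) s n
  rwa [move_update, if_pos hn] at this

theorem play_update_eq_of_ne [DecidableEq Agt] {σ : A.Profile} {i : Agt} {τ : A.Strategy i}
    {s : A.State} {n : ℕ} (hn : (A.play (Function.update σ i τ) s n).1.1 ≠ i) :
    A.play (Function.update σ i τ) s n =
      A.move σ (A.hist (A.play (Function.update σ i τ) s) n)
        (A.play (Function.update σ i τ) s n).1 := by
  have := A.play_eq_move (Function.update σ i τ) s n
  rwa [A.move_update_of_ne _ _ _ hn] at this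

/-- A profile that follows the run `p h` after every history `h` at which this is possible. -/
theorem exists_profile_following (σ : A.Profile) (p : List A.Step → ℕ → A.Step) :
    ∃ σ' : A.Profile, ∀ h s, (p h h.length).1 = s → A.move σ' h s = p h h.length := by
  obtain ⟨σ', hσ'⟩ := A.exists_profile
    (fun h s => if (p h h.length).1 = s then p h h.length else A.move σ h s) (fun h s => by
      split_ifs with hs
      · exact hs
      · rfl)
  exact ⟨σ', fun h s hs => by rw [hσ', if_pos hs]⟩

/-- From the histories in `R`, the players in `own` win for the objective `φ` with the positional
strategy `s` on the tree of histories. -/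
structure WinningRegion (own : Agt → Prop) (φ : Set (ℕ → A.Step)) (R : Set (List A.Step × A.State))
    (s : List A.Step × A.State → List A.Step × A.State) : Prop where
  move : ∀ v ∈ R, own v.2.1 → A.Edge v (s v) ∧ s v ∈ R
  closed : ∀ v ∈ R, ¬ own v.2.1 → ∀ w, A.Edge v w → w ∈ R
  wins : ∀ ρ, A.IsRun ρ → ∀ m, A.vert [] ρ m ∈ R → (∀ n, m ≤ n → A.vert [] ρ n ∈ R →
    own (ρ n).1.1 → A.vert [] ρ (n + 1) = s (A.vert [] ρ n)) → ρ ∈ φ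

theorem winningRegion_of_dominion {own : Agt → Prop} {φ : Set (ℕ → A.Step)}
    {R : Set (List A.Step × A.State)} {s : List A.Step × A.State → List A.Step × A.State}
    {c : List A.Step × A.State → ℕ} {b : Bool}
    (hc : ∀ ρ, A.IsRun ρ → ParityWin c b (A.vert [] ρ) → ρ ∈ φ)
    (h : Dominion A.Edge (fun v => own v.2.1) Set.univ ∅ (ParityWin c b) R s) :
    A.WinningRegion own φ R s := by
  refine ⟨fun v hv ho => h.move v hv (by simp) ho,
    fun v hv ho w hw => h.closed v hv (by simp) ho w (by simp) hw, fun ρ hρ m hm hs => ?_⟩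
  refine hc ρ hρ ((parityWin_shift _ _ _ m).1 (h.wins_of_mem
    (fun π k => (parityWin_shift _ _ π k).1) (fun n => ?_) (by simp) (by simp)
    (fun n hn ho => ?_) (m := 0) (by simpa using hm)))
  · rw [Nat.add_right_comm]
    exact A.edge_vert hρ [] _
  · rw [Nat.add_right_comm]
    exact hs _ (by omega) hn ho

/-- Player `k` against the coalition of all others: determinacy makes the two regions complementary.
-/
theorem IsOmegaRegular.exists_winningRegion {φ : Set (ℕ → A.Step)} (hφ : A.IsOmegaRegular φ)
    (hne : ∀ s : A.State, Nonempty (A.Act s.1)) (k : Agt) :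
    ∃ R s t, A.WinningRegion (fun i => i = k) φ R s ∧ A.WinningRegion (fun i => i ≠ k) φᶜ Rᶜ t := by
  obtain ⟨c, d, hc, hwin⟩ := IsOmegaRegular.exists_color_init A hφ
  obtain ⟨R, s, hcov, hdom⟩ := parity_determined A.Edge (fun v => decide (v.2.1 = k)) c d Set.univ
    (fun v _ => by simpa using A.edge_total hne v) (fun v _ => hc v)
  have hdt : Dominion A.Edge (fun v => v.2.1 = k) Set.univ ∅ (ParityWin c true) (R true)
      (s true) := by simpa using hdom true
  have hdf : Dominion A.Edge (fun v => ¬ v.2.1 = k) Set.univ ∅ (ParityWin c false) (R false)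
      (s false) := by simpa using hdom false
  have heq : R false = (R true)ᶜ := by
    ext v
    refine ⟨fun hv hv' => hdt.notMem_of_mem hdf hv' hv, fun hv => ?_⟩
    exact (hcov v (by simp)).resolve_left hv
  refine ⟨R true, s true, s false, A.winningRegion_of_dominion (fun ρ hρ h => ?_) hdt,
    A.winningRegion_of_dominion (b := false) (c := c) (fun ρ hρ h => ?_) (heq ▸ hdf)⟩
  · exact ((hwin ρ hρ true).1 h).2 rfl
  · intro hρ'
    exact absurd (((hwin ρ hρ false).1 h).1 hρ') (by simp)

/-- A run that extends the given history in reverse order, kept as long as it is `good`. -/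
noncomputable def planRev (good : (ℕ → A.Step) → List A.Step → Prop) (ρ : ℕ → A.Step) :
    List A.Step → ℕ → A.Step
  | [] => ρ
  | t :: r => if good (planRev good ρ r) (r.reverse ++ [t]) then planRev good ρ r
      else @Classical.epsilon _ ⟨ρ⟩ fun p => good p (r.reverse ++ [t])

/-- A run that extends the given history, starting with `ρ` and kept as long as it is `good`. -/
noncomputable def plan (good : (ℕ → A.Step) → List A.Step → Prop) (ρ : ℕ → A.Step)
    (h : List A.Step) : ℕ → A.Step :=
  A.planRev good ρ h.reverse

theorem plan_concat (good : (ℕ → A.Step) → List A.Step → Prop) (ρ : ℕ → A.Step) (h : List A.Step)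
    (t : A.Step) : A.plan good ρ (h ++ [t]) =
      if good (A.plan good ρ h) (h ++ [t]) then A.plan good ρ h
      else @Classical.epsilon _ ⟨ρ⟩ fun p => good p (h ++ [t]) := by
  simp only [plan, List.reverse_append, List.reverse_singleton, List.singleton_append, planRev,
    List.reverse_reverse]
  congr

theorem good_plan {good : (ℕ → A.Step) → List A.Step → Prop} {ρ : ℕ → A.Step} (h0 : good ρ [])
    {h : List A.Step} (hex : ∃ p, good p h) : good (A.plan good ρ h) h := by
  rcases List.eq_nil_or_concat' h with rfl | ⟨r, t, rfl⟩
  · exact h0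
  · rw [plan_concat]
    split_ifs with hg
    · exact hg
    · exact Classical.epsilon_spec hex

/-- Along its own run a plan is never revised. -/
theorem plan_hist {good : (ℕ → A.Step) → List A.Step → Prop} {ρ p : ℕ → A.Step} {m : ℕ}
    (hp : ∀ n, good p (A.hist p n)) (hm : A.plan good ρ (A.hist p m) = p) {n : ℕ} (hn : m ≤ n) :
    A.plan good ρ (A.hist p n) = p := by
  induction n, hn using Nat.le_induction with
  | base => exact hm
  | succ n _ ih =>
    rw [hist_succ, plan_concat, ih, ← hist_succ, if_pos (hp _)]

end Arena

namespace ArenaGame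

open Filter Classical GraphGame

variable {Agt : Type u} (G : ArenaGame.{u, v, w} Agt)

theorem models_univ {σ : G.Profile} {φ : Set (ℕ → G.Step)} :
    G.Models Set.univ σ φ ↔ G.toArena.play σ G.init ∈ φ := by
  rw [Models, Arena.outcomes_univ, Set.singleton_subset_iff]

variable [DecidableEq Agt]

theorem winsAgainst_iff {i : Agt} {τ : G.Strategy i} {σ : G.Profile} :
    G.WinsAgainst τ σ ↔ G.toArena.play (Function.update σ i τ) G.init ∈ G.obj i :=
  G.models_univ

variable {G}

/-- An admissible strategy does not leave the winning region. -/
theorem Admissible.mem_winningRegion {k : Agt} {R : Set (List G.Step × G.State)}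
    {s t : List G.Step × G.State → List G.Step × G.State}
    (hR : G.WinningRegion (fun i => i = k) (G.obj k) R s)
    (hQ : G.WinningRegion (fun i => i ≠ k) (G.obj k)ᶜ Rᶜ t)
    {T : G.Profile} (hT : G.Admissible (T k)) {ρ : ℕ → G.Step} (hρ : G.IsRun ρ)
    (h0 : (ρ 0).1 = G.init)
    (hcomp : ∀ n, (ρ n).1.1 = k → ρ n = G.toArena.move T (G.hist ρ n) (ρ n).1) {m n : ℕ}
    (hmn : m ≤ n) (hm : G.toArena.vert [] ρ m ∈ R) : G.toArena.vert [] ρ n ∈ R := by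
  by_contra hn
  -- The dominating strategy: keep `T`, but after the prefix of `ρ` of length `m` switch to the
  -- winning strategy `s` within `R`.
  obtain ⟨T', hT'1, hT'2⟩ := G.toArena.exists_profile_of_strategy
    (S := {v | v ∈ R ∧ v.2.1 = k ∧ m ≤ v.1.length ∧ v.1.take m = G.hist ρ m}) (t := s)
    (fun v hv => (hR.move v hv.1 hv.2.1).1) T
  have hwin : ∀ r, G.IsRun r → (r 0).1 = G.init → G.hist r m = G.hist ρ m →
      (∀ n, (r n).1.1 = k → r n = G.toArena.move T' (G.hist r n) (r n).1) → r ∈ G.obj k := by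
    intro r hr hr0 hrm hrT
    refine hR.wins r hr m ?_ fun j hj hjR ho => ?_
    · rw [G.toArena.vert_eq_of_hist_eq hr hρ (hr0.trans h0.symm) hrm]
      exact hm
    · rw [G.toArena.vert_succ hr, hrT j ho]
      exact hT'1 (G.toArena.vert [] r j) ⟨hjR, ho, by simpa [Arena.vert] using hj,
        (G.toArena.take_hist r hj).trans hrm⟩
  refine hT ⟨T' k, fun σ hσ => ?_, ?_⟩
  · rw [winsAgainst_iff] at hσ ⊢
    set r := G.toArena.play (Function.update σ k (T' k)) G.init with hr
    have hrun : G.IsRun r := G.toArena.isRun_play _ _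
    by_cases hrm : G.hist r m = G.hist ρ m
    · exact hwin r hrun rfl hrm fun n hn => G.toArena.play_update_eq_of_eq hn
    · rwa [hr, G.toArena.play_congr (σ' := Function.update σ k (T k))]
      intro j
      rw [← hr, Arena.move_update, Arena.move_update]
      by_cases ho : (r j).1.1 = k
      · rw [if_pos ho, if_pos ho]
        refine hT'2 (G.hist r j, (r j).1) fun hS => hrm ?_
        rw [← hS.2.2.2]
        exact (G.toArena.take_hist r (by simpa using hS.2.2.1)).symm
      · rw [if_neg ho, if_neg ho]
  -- The others follow `ρ` up to its exit from `R` and then play `t`: `T` loses against this and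
  -- `T'` wins.
  · obtain ⟨P, hP⟩ := G.toArena.exists_profile_following T fun _ => ρ
    obtain ⟨σ, hσ1, hσ2⟩ := G.toArena.exists_profile_of_strategy
      (S := {v | v ∈ Rᶜ ∧ v.2.1 ≠ k ∧ n ≤ v.1.length}) (t := t)
      (fun v hv => (hQ.move v hv.1 hv.2.1).1) P
    have hfollow : ∀ (r : ℕ → G.Step) j, j < n → G.hist r j = G.hist ρ j → (r j).1 = (ρ j).1 →
        G.toArena.move σ (G.hist r j) (r j).1 = ρ j := by
      intro r j hj hrj hs
      have h1 := hσ2 (G.hist r j, (r j).1) fun hS => by simpa using hj.trans_le hS.2.2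
      have h2 := hP (G.hist r j) (r j).1 (by simp [hs])
      simpa using h1.trans h2
    refine ⟨σ, ?_, ?_⟩
    · rw [winsAgainst_iff]
      refine hwin _ (G.toArena.isRun_play _ _) rfl ?_ fun n hn => G.toArena.play_update_eq_of_eq hn
      refine G.toArena.hist_eq_of_forall_step (G.toArena.isRun_play _ _) hρ h0.symm
        fun j hj hh hs => ?_
      by_cases ho : (ρ j).1.1 = k
      · rw [G.toArena.play_update_eq_of_eq (by rw [hs]; exact ho), hh, hs, hcomp j ho]
        refine hT'2 (G.hist ρ j, (ρ j).1) fun hS => ?_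
        simpa using hj.trans_le hS.2.2.1
      · rw [G.toArena.play_update_eq_of_ne (by rw [hs]; exact ho)]
        exact hfollow _ j (by omega) hh hs
    · rw [winsAgainst_iff]
      set r := G.toArena.play (Function.update σ k (T k)) G.init with hr
      have hrun : G.IsRun r := G.toArena.isRun_play _ _
      have hrn : G.hist r n = G.hist ρ n := by
        refine G.toArena.hist_eq_of_forall_step hrun hρ h0.symm fun j hj hh hs => ?_
        by_cases ho : (ρ j).1.1 = k
        · rw [hr, G.toArena.play_update_eq_of_eq (by rw [← hr, hs]; exact ho), ← hr, hh, hs,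
            ← hcomp j ho]
        · rw [hr, G.toArena.play_update_eq_of_ne (by rw [← hr, hs]; exact ho)]
          exact hfollow _ j hj hh hs
      refine hQ.wins r hrun n ?_ fun j hj hjR ho => ?_
      · rw [G.toArena.vert_eq_of_hist_eq hrun hρ h0.symm hrn]
        exact hn
      · rw [G.toArena.vert_succ hrun, hr, G.toArena.play_update_eq_of_ne ho]
        exact hσ1 (G.toArena.vert [] r j) ⟨hjR, ho, by simpa [Arena.vert] using hj⟩

/-- A run that is won by player `k` and does not leave her winning region is compatible with an
admissible strategy of player `k`. -/
theorem exists_admissible_of_run {k : Agt} {R : Set (List G.Step × G.State)}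
    {s t : List G.Step × G.State → List G.Step × G.State}
    (hR : G.WinningRegion (fun i => i = k) (G.obj k) R s)
    (hQ : G.WinningRegion (fun i => i ≠ k) (G.obj k)ᶜ Rᶜ t) (σ₀ : G.Profile)
    {ρ : ℕ → G.Step} (hρ : G.IsRun ρ) (h0 : (ρ 0).1 = G.init) (hk : ρ ∈ G.obj k)
    (hstay : ∀ m n, m ≤ n → G.toArena.vert [] ρ m ∈ R → G.toArena.vert [] ρ n ∈ R) :
    ∃ T : G.Profile, G.Admissible (T k) ∧
      ∀ n, (ρ n).1.1 = k → ρ n = G.toArena.move T (G.hist ρ n) (ρ n).1 := by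
  let good : (ℕ → G.Step) → List G.Step → Prop := fun p h =>
    G.IsRun p ∧ (p 0).1 = G.init ∧ p ∈ G.obj k ∧ G.hist p h.length = h
  have hgood : ∀ {p h}, good p h → ∀ n, good p (G.hist p n) := fun hp n =>
    ⟨hp.1, hp.2.1, hp.2.2.1, by simp⟩
  have hgρ : good ρ [] := ⟨hρ, h0, hk, rfl⟩
  obtain ⟨B, hB⟩ := G.toArena.exists_profile_following σ₀ (G.toArena.plan good ρ)
  -- Off `ρ` and inside `R` play the winning strategy; otherwise pursue a won run compatible with
  -- the history, starting with `ρ` and changing the plan only when it breaks.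
  obtain ⟨T, hT1, hT2⟩ := G.toArena.exists_profile_of_strategy
    (S := {v | v ∈ R ∧ v.2.1 = k ∧ G.hist ρ v.1.length ≠ v.1}) (t := s)
    (fun v hv => (hR.move v hv.1 hv.2.1).1) B
  have hTplan : ∀ (p : ℕ → G.Step) n, G.toArena.plan good ρ (G.hist p n) = p →
      (G.toArena.vert [] p n ∉ R ∨ G.hist ρ n = G.hist p n) →
      G.toArena.move T (G.hist p n) (p n).1 = p n := by
    intro p n hp hor
    have h1 := hT2 (G.hist p n, (p n).1) fun hS => by
      rcases hor with h | h
      · exact h hS.1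
      · exact hS.2.2 (by simpa using h)
    have h2 := hB (G.hist p n) (p n).1 (by simp [hp])
    rw [hp] at h2
    simpa using h1.trans h2
  have hTρ : ∀ n, G.toArena.move T (G.hist ρ n) (ρ n).1 = ρ n := fun n =>
    hTplan ρ n (G.toArena.plan_hist (hgood hgρ) (m := 0) rfl (Nat.zero_le n)) (Or.inr rfl)
  -- after a history in the winning region, the strategy wins
  have hwin : ∀ r, G.IsRun r → (r 0).1 = G.init →
      (∀ n, (r n).1.1 = k → r n = G.toArena.move T (G.hist r n) (r n).1) →
      ∀ m, G.toArena.vert [] r m ∈ R → r ∈ G.obj k := by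
    intro r hr hr0 hrT m hm
    by_cases hrρ : r = ρ
    · rwa [hrρ]
    obtain ⟨D, hD1, hD2, hD3⟩ := G.toArena.exists_first_difference hr hρ (hr0.trans h0.symm) hrρ
    have hvD : ∀ j ≤ D, G.toArena.vert [] r j = G.toArena.vert [] ρ j := fun j hj =>
      G.toArena.vert_eq_of_hist_eq hr hρ (hr0.trans h0.symm) (G.toArena.hist_eq_of_le hD1 hj)
    have hoD : (r D).1.1 ≠ k := by
      intro ho
      refine hD3 ((hrT D ho).trans ?_)
      rw [hD1, hD2, hTρ]
    -- Only another player can leave `ρ`, and such a move does not leave `R`. So the run is in `R`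
    -- at some time past `D`, from which `s` is played.
    obtain ⟨m', hm', hm'R⟩ : ∃ m', D < m' ∧ G.toArena.vert [] r m' ∈ R := by
      rcases le_or_gt m D with hmD | hmD
      · refine ⟨D + 1, Nat.lt_succ_self D, ?_⟩
        refine hR.closed (G.toArena.vert [] r D) ?_ hoD _ (G.toArena.edge_vert hr [] D)
        rw [hvD D le_rfl]
        exact hstay m D hmD (hvD m hmD ▸ hm)
      · exact ⟨m, hmD, hm⟩
    refine hR.wins r hr m' hm'R fun n hn hnR ho => ?_
    rw [G.toArena.vert_succ hr, hrT n ho]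
    refine hT1 (G.toArena.vert [] r n) ⟨hnR, ho, fun e => hD3 ?_⟩
    have e' : G.hist ρ n = G.hist r n := by simpa [Arena.vert] using e
    exact ((G.toArena.hist_eq_iff).1 e' D (by omega)).symm
  refine ⟨T, ?_, fun n _ => (hTρ n).symm⟩
  rintro ⟨τ, hdom, σ₁, hw, hl⟩
  obtain ⟨T', rfl⟩ : ∃ T' : G.Profile, T' k = τ := ⟨Function.update T k τ, by simp⟩
  rw [winsAgainst_iff] at hw hl
  set r₁ := G.toArena.play (Function.update σ₁ k (T k)) G.init with hr₁
  set r₂ := G.toArena.play (Function.update σ₁ k (T' k)) G.init with hr₂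
  have hrun₁ : G.IsRun r₁ := G.toArena.isRun_play _ _
  have hrun₂ : G.IsRun r₂ := G.toArena.isRun_play _ _
  have hT₁ : ∀ n, (r₁ n).1.1 = k → r₁ n = G.toArena.move T (G.hist r₁ n) (r₁ n).1 :=
    fun n hn => G.toArena.play_update_eq_of_eq hn
  have hT₂ : ∀ n, (r₂ n).1.1 = k → r₂ n = G.toArena.move T' (G.hist r₂ n) (r₂ n).1 :=
    fun n hn => G.toArena.play_update_eq_of_eq hn
  obtain ⟨N, hN1, hN2, hN3⟩ := G.toArena.exists_first_difference hrun₁ hrun₂ rfl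
    (fun e => hl (e ▸ hw))
  have hoN : (r₁ N).1.1 = k := by
    by_contra ho
    have h1 : r₁ N = G.toArena.move σ₁ (G.hist r₁ N) (r₁ N).1 :=
      G.toArena.play_update_eq_of_ne ho
    have h2 : r₂ N = G.toArena.move σ₁ (G.hist r₂ N) (r₂ N).1 :=
      G.toArena.play_update_eq_of_ne (hN2 ▸ ho)
    rw [← hN1, ← hN2] at h2
    exact hN3 (h1.trans h2.symm)
  have hvN : G.toArena.vert [] r₁ N ∉ R := fun h => hl (hwin r₁ hrun₁ rfl hT₁ N h)
  have hvN' : G.toArena.vert [] r₂ (N + 1) ∈ Rᶜ := by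
    refine hQ.closed (G.toArena.vert [] r₂ N) ?_ (not_not.2 ?_) _ (G.toArena.edge_vert hrun₂ [] N)
    · rwa [← G.toArena.vert_eq_of_hist_eq hrun₁ hrun₂ rfl hN1]
    · exact (congrArg Sigma.fst hN2).symm.trans hoN
  -- The won run `r₂` shows that the common history can still be won, so `T` has a valid plan `p`
  -- here. Opponents who follow `p` and play `t` off it will let `T` win and make `T'` lose.
  obtain ⟨p, hp⟩ : ∃ p, p = G.toArena.plan good ρ (G.hist r₁ N) := ⟨_, rfl⟩
  have hgp : good p (G.hist r₁ N) := by
    rw [hp]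
    exact G.toArena.good_plan hgρ ⟨r₂, hrun₂, rfl, hw, by simp [hN1]⟩
  have hpN : G.hist p N = G.hist r₁ N := by simpa using hgp.2.2.2
  have hpplan : ∀ n, N ≤ n → G.toArena.plan good ρ (G.hist p n) = p := fun n hn =>
    G.toArena.plan_hist (hgood hgp) (m := N) (by rw [hpN, ← hp]) hn
  have hpN' : r₁ N = p N := by
    have hs := G.toArena.state_eq_of_hist_eq hrun₁ hgp.1 hgp.2.1.symm hpN.symm
    rw [hT₁ N hoN, ← hpN, hs]
    refine hTplan p N (hpplan N le_rfl) (Or.inl ?_)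
    rwa [G.toArena.vert_eq_of_hist_eq hgp.1 hrun₁ hgp.2.1 hpN]
  obtain ⟨P, hP⟩ := G.toArena.exists_profile_following σ₀ fun _ => p
  obtain ⟨σ₃, hσ1, hσ2⟩ := G.toArena.exists_profile_of_strategy
    (S := {v | v ∈ Rᶜ ∧ v.2.1 ≠ k ∧ G.hist p v.1.length ≠ v.1}) (t := t)
    (fun v hv => (hQ.move v hv.1 hv.2.1).1) P
  have hσp : ∀ (r : ℕ → G.Step) n, G.hist r n = G.hist p n → (r n).1 = (p n).1 →
      G.toArena.move σ₃ (G.hist r n) (r n).1 = p n := by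
    intro r n hh hs
    have h1 := hσ2 (G.hist r n, (r n).1) fun hS => hS.2.2 (by simp [hh])
    have h2 := hP (G.hist r n) (r n).1 (by simp [hs])
    simpa using h1.trans h2
  have hw₃ : G.WinsAgainst (T k) σ₃ := by
    rw [winsAgainst_iff]
    set r := G.toArena.play (Function.update σ₃ k (T k)) G.init with hr
    have hrun : G.IsRun r := G.toArena.isRun_play _ _
    by_cases hrp : r = p
    · rw [hrp]
      exact hgp.2.2.1
    obtain ⟨D, hD1, hD2, hD3⟩ :=
      G.toArena.exists_first_difference hrun hgp.1 hgp.2.1.symm hrp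
    have hoD : (r D).1.1 = k := by
      by_contra ho
      refine hD3 ?_
      rw [hr, G.toArena.play_update_eq_of_ne ho]
      exact hσp r D hD1 hD2
    have hrD : r D = G.toArena.move T (G.hist p D) (p D).1 := by
      rw [← hD1, ← hD2]
      exact G.toArena.play_update_eq_of_eq hoD
    have hND : N ≤ D := by
      by_contra! hlt
      refine hD3 (hrD.trans ?_)
      have h1 := G.toArena.hist_eq_iff.1 hpN D hlt
      rw [G.toArena.hist_eq_of_le hpN hlt.le, h1]
      exact (hT₁ D (by rw [← h1, ← hD2]; exact hoD)).symm
    -- `T` abandons `p` only inside `R`, where it wins anyway.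
    refine hwin r hrun rfl (fun n hn => G.toArena.play_update_eq_of_eq hn) D ?_
    rw [G.toArena.vert_eq_of_hist_eq hrun hgp.1 hgp.2.1.symm hD1]
    by_contra hnR
    exact hD3 (hrD.trans (hTplan p D (hpplan D hND) (Or.inl hnR)))
  have hw₄ := hdom σ₃ hw₃
  rw [winsAgainst_iff] at hw₄
  set r := G.toArena.play (Function.update σ₃ k (T' k)) G.init with hr
  have hrun : G.IsRun r := G.toArena.isRun_play _ _
  have hrN : G.hist r N = G.hist r₂ N := by
    refine G.toArena.hist_eq_of_forall_step hrun hrun₂ rfl fun j hj hh hs => ?_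
    by_cases ho : (r j).1.1 = k
    · rw [hT₂ j (hs ▸ ho), ← hh, ← hs]
      exact G.toArena.play_update_eq_of_eq ho
    · have h1 : G.hist p N = G.hist r₂ N := hpN.trans hN1
      have h2 := G.toArena.hist_eq_iff.1 h1 j hj
      rw [← h2, hr, G.toArena.play_update_eq_of_ne ho]
      exact hσp r j (hh.trans (G.toArena.hist_eq_of_le h1 hj.le).symm) (by rw [hs, h2])
  have hsN : (r N).1 = (r₂ N).1 := G.toArena.state_eq_of_hist_eq hrun hrun₂ rfl hrN
  have hoN₂ : (r₂ N).1.1 = k := hN2 ▸ hoN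
  have hrN' : r N = r₂ N := by
    rw [hT₂ N hoN₂, ← hrN, ← hsN]
    exact G.toArena.play_update_eq_of_eq (by rw [← hr, hsN]; exact hoN₂)
  refine hQ.wins r hrun (N + 1) ?_ (fun n hn hnR ho => ?_) hw₄
  · rwa [G.toArena.vert_eq_of_hist_eq hrun hrun₂ rfl
      (by rw [Arena.hist_succ, Arena.hist_succ, hrN, hrN'])]
  · rw [G.toArena.vert_succ hrun, hr, G.toArena.play_update_eq_of_ne ho]
    refine hσ1 (G.toArena.vert [] r n) ⟨hnR, ho, fun e => hN3 ?_⟩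
    have e' : G.hist p n = G.hist r n := by simpa [Arena.vert] using e
    rw [hpN', (G.toArena.hist_eq_iff).1 e' N (by omega), hrN']

/-- The AA solution is changed only at histories where the opponent has left her winning region;
there she is made to lose. The outcome of the AA solution never gets there, as both strategies are
admissible. If the opponent wins, she never left, so the run follows the AA strategy against an
admissible one. -/
theorem AA.agAnd (h : G.AA) (hG : G.OmegaRegular) (hcard : Nat.card Agt = 2) : G.AGAnd := by
  obtain ⟨σ, hadm, hwin⟩ := h
  have hne : ∀ s : G.State, Nonempty (G.Act s.1) := fun s => ⟨σ s.1 [] s.2⟩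
  choose R s t hR hQ using fun k => Arena.IsOmegaRegular.exists_winningRegion G.toArena (hG k) hne k
  have hother : ∀ i : Agt, ∃ k, k ≠ i ∧ ∀ j, j ≠ i → j = k := fun i => by
    obtain ⟨k, hk, hu⟩ := (Nat.card_eq_two_iff' i).1 hcard
    exact ⟨k, hk, hu⟩
  choose o ho ho' using hother
  obtain ⟨σ', hσ1, hσ2⟩ := G.toArena.exists_profile_of_strategy
    (S := {v | v ∉ R (o v.2.1) ∧ ∃ m, ∃ st ∈ v.1[m]?, (v.1.take m, st.1) ∈ R (o v.2.1)})
    (t := fun v => t (o v.2.1) v)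
    (fun v hv => ((hQ (o v.2.1)).move v hv.1 (ho v.2.1).symm).1) σ
  have hfollow : ∀ ρ n, (∀ m < n, G.toArena.vert [] ρ m ∈ R (o (ρ n).1.1) →
      G.toArena.vert [] ρ n ∈ R (o (ρ n).1.1)) →
      G.toArena.move σ' (G.hist ρ n) (ρ n).1 = G.toArena.move σ (G.hist ρ n) (ρ n).1 := by
    intro ρ n hst
    refine hσ2 (G.hist ρ n, (ρ n).1) ?_
    rintro ⟨h1, m, st, hm, h2⟩
    dsimp only at h1 hm h2
    rw [Arena.getElem?_hist] at hm
    split_ifs at hm with hlt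
    · obtain rfl : ρ m = st := by simpa using hm
      rw [G.toArena.take_hist _ hlt.le] at h2
      exact h1 (hst m hlt h2)
    · simp at hm
  refine ⟨σ', ?_, fun i ρ hρ hall => ?_⟩
  · have hplay : G.toArena.play σ G.init = G.toArena.play σ' G.init := by
      refine G.toArena.play_congr fun n => (hfollow _ n fun m hm hmR => ?_).symm
      exact (hadm _).mem_winningRegion (hR _) (hQ _) (G.toArena.isRun_play _ _) rfl
        (fun n _ => G.toArena.play_eq_move _ _ n) hm.le hmR
    rw [models_univ, ← hplay]
    intro i
    have := hwin i σ fun j _ => hadm j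
    rwa [winsAgainst_iff, Function.update_eq_self] at this
  · rw [Arena.mem_outcomes_iff] at hρ
    obtain ⟨hrun, h0, hcomp⟩ := hρ
    -- Leaving would trigger the punishment, contradicting that the opponent wins `ρ`.
    have hstay : ∀ m n, m ≤ n → G.toArena.vert [] ρ m ∈ R (o i) →
        G.toArena.vert [] ρ n ∈ R (o i) := by
      intro m n hmn hm
      by_contra hn
      refine (hQ (o i)).wins ρ hrun n hn (fun l hl hlR hlo => ?_) (hall _ (ho i))
      have hli : (ρ l).1.1 = i := by
        by_contra h
        exact hlo (ho' i _ h)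
      have hml : m < l := by
        rcases hmn.eq_or_lt with rfl | h
        · exact absurd hm hn
        · omega
      rw [G.toArena.vert_succ hrun, hcomp l hli]
      have := hσ1 (G.toArena.vert [] ρ l) ⟨?_, m, ρ m, ?_, ?_⟩
      · simp only [Arena.vert, hli] at this ⊢
        exact this
      · simp only [Arena.vert, hli]
        exact hlR
      · exact (G.toArena.getElem?_hist ρ m l).trans (if_pos hml)
      · simp only [Arena.vert, hli, List.nil_append, G.toArena.take_hist ρ hml.le]
        exact hm
    have hσρ : ∀ n, (ρ n).1.1 = i → ρ n = G.toArena.move σ (G.hist ρ n) (ρ n).1 := by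
      intro n hn
      rw [← hfollow ρ n fun m hm => by rw [hn]; exact hstay m n hm.le]
      exact hcomp n hn
    obtain ⟨T, hT, hTρ⟩ := exists_admissible_of_run (hR (o i)) (hQ (o i)) σ hrun h0
      (hall _ (ho i)) hstay
    have hw := hwin i (Function.update σ (o i) (T (o i))) fun j hj => by
      obtain rfl := ho' i j hj
      simpa using hT
    rw [winsAgainst_iff] at hw
    convert hw
    refine G.toArena.eq_play hrun h0 fun n => ?_
    rw [Arena.move_update]
    split_ifs with hn
    · exact hσρ n hn
    · have := ho' i _ hn
      rw [Arena.move_update, if_pos this]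
      exact hTρ n this

end ArenaGame

/-! ### Implications between the rules -/

namespace ArenaGame

open Classical

variable {Agt : Type u} {G : ArenaGame.{u, v, w} Agt}

theorem Models.univ_of_eq {i : Agt} {σ σ' : G.Profile} {φ : Set (ℕ → G.Step)}
    (h : G.Models {i} σ φ) (he : σ' i = σ i) : G.Models Set.univ σ' φ := by
  rintro ρ ⟨hρ, h0, hσ⟩
  refine h ⟨hρ, h0, ?_⟩
  rintro j rfl
  exact he ▸ hσ j trivial

theorem AGOr.agAnd (h : G.AGOr) : G.AGAnd := by
  obtain ⟨σ, h1, h2⟩ := h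
  refine ⟨σ, h1, fun i ρ hρ hall => ?_⟩
  -- A lone player makes the disjunction false and the conjunction true; then her own strategy is
  -- the whole profile.
  by_cases hex : ∃ j, j ≠ i
  · obtain ⟨j, hj⟩ := hex
    exact h2 i hρ ⟨j, hj, hall j hj⟩
  · push Not at hex
    refine h1 ⟨hρ.1, hρ.2.1, fun j _ => hρ.2.2 j (hex j)⟩ i

theorem AGAnd.coop (h : G.AGAnd) : G.Coop :=
  h.imp fun _ hσ => hσ.1

theorem Win.agOr (h : G.Win) : G.AGOr := by
  obtain ⟨σ, hσ⟩ := h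
  exact ⟨σ, fun ρ hρ i => (hσ i).univ_of_eq rfl hρ, fun i ρ hρ _ => hσ i hρ⟩

variable [DecidableEq Agt]

theorem admissible_of_forall_winsAgainst {i : Agt} {τ : G.Strategy i}
    (h : ∀ σ, G.WinsAgainst τ σ) : G.Admissible τ := by
  rintro ⟨_, _, σ, _, hσ⟩
  exact hσ (h σ)

theorem Win.aa (h : G.Win) : G.AA := by
  obtain ⟨σ, hσ⟩ := h
  have hw : ∀ i σ', G.WinsAgainst (σ i) σ' := fun i σ' => (hσ i).univ_of_eq (by simp)
  exact ⟨σ, fun i => admissible_of_forall_winsAgainst (hw i), fun i σ' _ => hw i σ'⟩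

theorem AA.coop (h : G.AA) : G.Coop := by
  obtain ⟨σ, hadm, hwin⟩ := h
  refine ⟨σ, fun ρ hρ i => ?_⟩
  have := hwin i σ fun j _ => hadm j
  rw [WinsAgainst, Function.update_eq_self] at this
  exact this hρ

theorem RSForall.rsExists {sys : Agt} {γ : SolutionConcept} (h : G.RSForall sys γ) :
    G.RSExists sys γ := by
  obtain ⟨τ, ⟨σ, hσ, hst⟩, hall⟩ := h
  exact ⟨σ, hst, hall σ hσ hst⟩

theorem Win.rsForall (h : G.Win) (sys : Agt) {γ : SolutionConcept} (hγ : γ ≠ SolutionConcept.SPE) :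
    G.RSForall sys γ := by
  obtain ⟨σ, hσ⟩ := h
  refine ⟨σ sys, ⟨σ, rfl, ?_⟩, fun σ' hσ' _ => (hσ sys).univ_of_eq hσ'⟩
  cases γ with
  | NE => exact fun i _ τ _ => (hσ i).univ_of_eq rfl
  | SPE => exact absurd rfl hγ
  | dom => exact fun j _ τ σ' _ _ => (hσ j).univ_of_eq (by simp)

theorem Coop.rsExists_NE (h : G.Coop) (sys : Agt) : G.RSExists sys SolutionConcept.NE := by
  obtain ⟨σ, hσ⟩ := h
  exact ⟨σ, fun i _ τ _ ρ hρ => hσ hρ i, fun ρ hρ => hσ hρ sys⟩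

/-- The winning strategy must come with an equilibrium of the others, so it is taken from a subgame
perfect profile. -/
theorem Win.rsForall_SPE (h : G.Win) (hG : G.OmegaRegular) (sys : Agt) :
    G.RSForall sys SolutionConcept.SPE := by
  obtain ⟨σ, hσ⟩ := h
  obtain ⟨σ', h1, h2⟩ := G.exists_subgamePerfect hG (fun s => ⟨σ s.1 [] s.2⟩) sys
  have hw := h2 ⟨σ, hσ sys⟩
  exact ⟨σ' sys, ⟨σ', rfl, fun h s hh i _ => h1 h s hh i trivial⟩,
    fun σ'' hσ'' _ => hw.univ_of_eq hσ''⟩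

/-- Follow a run that everybody wins, and a subgame perfect profile once it has been left. On
prefixes of the run nobody has anything to gain. -/
theorem Coop.rsExists_SPE (h : G.Coop) (hG : G.OmegaRegular) (sys : Agt) :
    G.RSExists sys SolutionConcept.SPE := by
  obtain ⟨σ, hσ⟩ := h
  obtain ⟨τ, hτ, -⟩ := G.exists_subgamePerfect hG (fun s => ⟨σ s.1 [] s.2⟩) sys
  rw [models_univ] at hσ
  set r := G.toArena.play σ G.init with hr
  have hrun : G.IsRun r := G.toArena.isRun_play _ _
  obtain ⟨σ', hσ'⟩ := G.toArena.exists_profile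
    (fun h s => if h = G.hist r h.length ∧ s = (r h.length).1 then G.toArena.move σ h s
      else G.toArena.move τ h s) (fun h s => by split_ifs <;> rfl)
  have hfollow : ∀ n, G.toArena.move σ' (G.hist r n) (r n).1 = r n := by
    intro n
    rw [hσ', if_pos (by simp)]
    exact (G.toArena.play_eq_move σ G.init n).symm
  refine ⟨σ', fun h s hh i _ T hT => ?_, ?_⟩
  · by_cases hpre : h = G.hist r h.length ∧ s = (r h.length).1
    · -- the history is a prefix of the cooperative run
      have hcat : ∀ n, h ++ G.hist (fun n => r (h.length + n)) n = G.hist r (h.length + n) := by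
        intro n
        induction n with
        | zero => simpa using hpre.1
        | succ n ih =>
          rw [Arena.hist_succ, ← List.append_assoc, ih, ← add_assoc, Arena.hist_succ]
      have heq : (fun n => r (h.length + n)) = G.toArena.play (G.shift σ' h) s := by
        refine G.toArena.eq_play (fun n => hrun _) hpre.2.symm fun n => ?_
        have : G.toArena.move (G.shift σ' h) (G.hist (fun n => r (h.length + n)) n)
            (r (h.length + n)).1 = G.toArena.move σ' (h ++ G.hist (fun n => r (h.length + n)) n)
              (r (h.length + n)).1 := rfl
        rw [this, hcat, hfollow]
      rw [Arena.outcomes_univ, Set.singleton_subset_iff, ← heq]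
      have hglue : G.glue h (fun n => r (h.length + n)) = r := by
        ext1 n
        rw [hpre.1, Arena.glue_hist]
        split_ifs with hn
        · rfl
        · rw [Arena.length_hist, Nat.add_sub_cancel' (by omega)]
      change G.glue h _ ∈ G.obj i
      rw [hglue]
      exact hσ i
    · have hoff : ∀ ρ : ℕ → G.Step, (ρ 0).1 = s → ∀ n,
          G.toArena.move (G.shift σ' h) (G.hist ρ n) (ρ n).1 =
            G.toArena.move (G.shift τ h) (G.hist ρ n) (ρ n).1 := by
        intro ρ h0 n
        refine (hσ' (h ++ G.hist ρ n) (ρ n).1).trans (if_neg ?_)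
        rintro ⟨e1, e2⟩
        have hlen : (h ++ G.hist ρ n).length = h.length + n := by simp
        rw [hlen] at e1 e2
        have h1 : h = G.hist r h.length := by
          have := congrArg (List.take h.length) e1
          rwa [List.take_left, G.toArena.take_hist r (by omega)] at this
        refine hpre ⟨h1, ?_⟩
        cases n with
        | zero => exact h0 ▸ e2
        | succ n =>
          have := congrArg (·[h.length]?) e1
          simp only [Arena.getElem?_hist, List.getElem?_append_right le_rfl, Nat.sub_self] at this
          rw [if_pos (by omega), if_pos (by omega)] at this
          rw [← h0, Option.some_injective _ this]
      have hplay : G.toArena.play (G.shift σ' h) s = G.toArena.play (G.shift τ h) s :=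
        G.toArena.play_congr (hoff _ rfl)
      have hplay' : G.toArena.play (Function.update (G.shift σ' h) i T) s =
          G.toArena.play (Function.update (G.shift τ h) i T) s := by
        refine G.toArena.play_congr fun n => ?_
        obtain ⟨T', rfl⟩ : ∃ T' : G.Profile, T' i = T := ⟨Function.update σ i T, by simp⟩
        rw [Arena.move_update, Arena.move_update, hoff _ rfl]
      have := hτ h s hh i trivial T
      rw [Arena.outcomes_univ, Arena.outcomes_univ, ← hplay, ← hplay', ← Arena.outcomes_univ,
        ← Arena.outcomes_univ] at this
      exact this hT
  · have heq : r = G.toArena.play σ' G.init :=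
      G.toArena.eq_play hrun rfl fun n => (hfollow n).symm
    rw [models_univ, ← heq]
    exact hσ sys

end ArenaGame

/-! ### Games with two moves -/

namespace TwoMove

open Filter

/-- The root, the nodes after the first move, and the leaves. -/
abbrev Node : Type := Option (Bool × Option Bool)

variable {Agt : Type}

/-- The first move belongs to `a`, the second to `b`. -/
def owner (a b : Agt) : Node → Agt
  | none => a
  | some _ => b

/-- The node after a move; the leaves are absorbing. -/
def advance : Node → Bool → Node
  | none, x => some (x, none)
  | some (x, none), y => some (x, some y)
  | some (x, some y), _ => some (x, some y)

/-- A node as a state of its owner. -/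
def toState (a b : Agt) (n : Node) : Σ i, {n : Node // owner a b n = i} := ⟨owner a b n, n, rfl⟩

/-- Player `a` chooses `x`, then player `b` chooses `y`; player `i` wins if `payoff i x y`. -/
def game (a b : Agt) (payoff : Agt → Bool → Bool → Prop) : ArenaGame.{0, 0, 0} Agt where
  Stat i := {n : Node // owner a b n = i}
  finite_stat _ := inferInstance
  init := toState a b none
  Act _ := Bool
  δ s x := toState a b (advance s.2.1 x)
  obj i := {ρ | ∃ x y, payoff i x y ∧
    ∃ᶠ n in atTop, (ρ n).1 = toState a b (some (x, some y))}

variable {a b : Agt} {payoff : Agt → Bool → Bool → Prop}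

theorem muller : (game a b payoff).Muller := fun i =>
  ⟨{X | ∃ x y, payoff i x y ∧ toState a b (some (x, some y)) ∈ X}, fun _ _ => Iff.rfl⟩

/-- The action of a step. -/
def act (t : (game a b payoff).Step) : Bool := t.2

theorem toState_injective : Function.Injective (toState a b) := fun _ _ h =>
  congrArg (fun s : Σ i, {n : Node // owner a b n = i} => s.2.1) h

theorem isRun_succ {ρ : ℕ → (game a b payoff).Step} (hρ : (game a b payoff).IsRun ρ) {n : ℕ}
    {m : Node} (h : (ρ n).1 = toState a b m) :
    (ρ (n + 1)).1 = toState a b (advance m (act (ρ n))) := by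
  have h1 : toState a b (advance (ρ n).1.2.1 (act (ρ n))) = (ρ (n + 1)).1 := hρ n
  rw [← h1, h]
  rfl

/-- The leaves are absorbing, so the only leaf visited infinitely often is the one reached after two
moves. -/
theorem mem_obj_iff {ρ : ℕ → (game a b payoff).Step} (hρ : (game a b payoff).IsRun ρ)
    (h0 : (ρ 0).1 = (game a b payoff).init) (i : Agt) :
    ρ ∈ (game a b payoff).obj i ↔ payoff i (act (ρ 0)) (act (ρ 1)) := by
  have h1 : (ρ 1).1 = toState a b (some (act (ρ 0), none)) := isRun_succ hρ h0
  have h2 : ∀ n, (ρ (n + 2)).1 = toState a b (some (act (ρ 0), some (act (ρ 1)))) := by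
    intro n
    induction n with
    | zero => exact isRun_succ hρ h1
    | succ n ih => exact isRun_succ hρ ih
  have h3 : ∀ᶠ n in atTop, (ρ n).1 = toState a b (some (act (ρ 0), some (act (ρ 1)))) := by
    filter_upwards [eventually_ge_atTop 2] with n hn
    obtain ⟨m, rfl⟩ := Nat.exists_eq_add_of_le' hn
    exact h2 m
  constructor
  · rintro ⟨x, y, hp, hf⟩
    obtain ⟨n, hn1, hn2⟩ := (hf.and_eventually h3).exists
    have := toState_injective (hn1.symm.trans hn2)
    simp only [Option.some.injEq, Prod.mk.injEq] at this
    rwa [← this.1, ← this.2]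
  · exact fun hp => ⟨_, _, hp, h3.frequently⟩

/-- The first move of a strategy of player `a`. -/
def first (τ : (game a b payoff).Strategy a) : Bool := τ [] ⟨none, rfl⟩

/-- The second move of a strategy of player `b`. -/
def second (τ : (game a b payoff).Strategy b) (x : Bool) : Bool :=
  τ [⟨(game a b payoff).init, x⟩] ⟨some (x, none), rfl⟩

/-- The strategy that plays `f x` after the first move `x`. -/
def respond (i : Agt) (f : Bool → Bool) : (game a b payoff).Strategy i := fun _ n =>
  f (n.1.elim false Prod.fst)

/-- No move precedes the root, so `f` receives the default `false` there. -/
theorem first_respond (f : Bool → Bool) :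
    first (respond a f : (game a b payoff).Strategy a) = f false := rfl

theorem second_respond (f : Bool → Bool) (x : Bool) :
    second (respond b f : (game a b payoff).Strategy b) x = f x := rfl

theorem act_zero {ρ : ℕ → (game a b payoff).Step} {P : Set Agt} {σ : (game a b payoff).Profile}
    (hρ : ρ ∈ (game a b payoff).outcomes (game a b payoff).init P σ) (ha : a ∈ P) :
    act (ρ 0) = first (σ a) :=
  congrArg act (hρ.2.2 a ha 0 ⟨none, rfl⟩ hρ.2.1)

theorem act_one {ρ : ℕ → (game a b payoff).Step} {P : Set Agt} {σ : (game a b payoff).Profile}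
    (hρ : ρ ∈ (game a b payoff).outcomes (game a b payoff).init P σ) (hb : b ∈ P) :
    act (ρ 1) = second (σ b) (act (ρ 0)) := by
  have h1 : (ρ 1).1 = toState a b (some (act (ρ 0), none)) := isRun_succ hρ.1 hρ.2.1
  have h2 := congrArg act (hρ.2.2 b hb 1 ⟨some (act (ρ 0), none), rfl⟩ h1)
  have h3 : ρ 0 = ⟨(game a b payoff).init, act (ρ 0)⟩ := by
    have h0 := hρ.2.1
    generalize ρ 0 = t at h0
    obtain ⟨s, x⟩ := t
    subst h0
    rfl
  have h4 : (game a b payoff).hist ρ 1 = [⟨(game a b payoff).init, act (ρ 0)⟩] := by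
    rw [← h3]
    rfl
  rw [h4] at h2
  exact h2

theorem models_obj_iff {σ : (game a b payoff).Profile} {i : Agt} :
    (game a b payoff).Models Set.univ σ ((game a b payoff).obj i) ↔
      payoff i (first (σ a)) (second (σ b) (first (σ a))) := by
  have h := (game a b payoff).toArena.play_mem_outcomes σ (game a b payoff).init Set.univ
  rw [ArenaGame.models_univ, mem_obj_iff h.1 h.2.1, act_one h trivial, act_zero h trivial]

theorem coop_iff : (game a b payoff).Coop ↔ ∃ σ : (game a b payoff).Profile,
    ∀ i, payoff i (first (σ a)) (second (σ b) (first (σ a))) := by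
  refine exists_congr fun σ => ?_
  rw [ArenaGame.models_univ]
  exact forall_congr' fun i => (ArenaGame.models_univ _).symm.trans models_obj_iff

/-- If the other players can choose moves such that they win and `i` loses, whatever the strategy
of `i`, then the rule AG-and has no solution. -/
theorem not_agAnd (i : Agt)
    (h : ∀ σ : (game a b payoff).Profile, ∃ σ' : (game a b payoff).Profile, σ' i = σ i ∧
      (∀ j, j ≠ i → payoff j (first (σ' a)) (second (σ' b) (first (σ' a)))) ∧
      ¬ payoff i (first (σ' a)) (second (σ' b) (first (σ' a)))) :
    ¬ (game a b payoff).AGAnd := by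
  rintro ⟨σ, -, hσ⟩
  obtain ⟨σ', he, h1, h2⟩ := h σ
  have h3 := (hσ i).univ_of_eq he
  rw [ArenaGame.models_univ] at h3
  have hiff : ∀ j, _ ↔ _ := fun j => (models_obj_iff (σ := σ') (i := j)).symm.trans
    (ArenaGame.models_univ _)
  exact h2 ((hiff i).2 (h3 fun j hj => (hiff j).1 (h1 j hj)))

theorem winsAgainst_iff [DecidableEq Agt] {i : Agt} {τ : (game a b payoff).Strategy i}
    {σ : (game a b payoff).Profile} : (game a b payoff).WinsAgainst τ σ ↔
      payoff i (first (Function.update σ i τ a))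
        (second (Function.update σ i τ b) (first (Function.update σ i τ a))) :=
  models_obj_iff

/-! ### The separating games. -/

theorem exists_ag_not_aa : ∃ G : ArenaGame.{0, 0, 0} (Fin 2),
    G.Muller ∧ G.AGOr ∧ G.AGAnd ∧ ¬ G.AA ∧ ¬ G.Win := by
  -- Player 0 needs `y` and player 1 needs both `x` and `y`. Playing `true` and copying it solves
  -- the AG rules.
  let payoff : Fin 2 → Bool → Bool → Prop := fun i x y => y = true ∧ (i = 1 → x = true)
  have hor : (game 0 1 payoff).AGOr := by
    refine ⟨fun i => if i = 0 then respond i fun _ => true else respond i id, ?_, fun i ρ hρ => ?_⟩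
    · rw [ArenaGame.models_univ]
      refine fun i => (ArenaGame.models_univ _).1 (models_obj_iff.2 ?_)
      exact ⟨rfl, fun _ => rfl⟩
    · rintro ⟨j, hj, hw⟩
      rw [mem_obj_iff hρ.1 hρ.2.1] at hw ⊢
      refine ⟨hw.1, fun hi => ?_⟩
      have := act_one hρ hi.symm
      exact this.symm.trans hw.1
  have haa : ¬ (game 0 1 payoff).AA := by
    rintro ⟨σ, hadm, hwin⟩
    -- Opening with `false` is admissible because an opponent may reply with the negation; but then
    -- player 1 cannot win.
    have hB : (game 0 1 payoff).Admissible (respond 0 fun _ => false) := by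
      rintro ⟨τ, hdom, σ₁, h1, h2⟩
      rw [winsAgainst_iff] at h1 h2
      cases hτ : first τ with
      | false =>
        apply h2
        simp only [Function.update_self, hτ] at h1
        exact ⟨h1.1, fun h => absurd h (by decide)⟩
      | true =>
        have h3 := hdom (fun i => respond i not)
          (winsAgainst_iff.2 ⟨rfl, fun h => absurd h (by decide)⟩)
        rw [winsAgainst_iff, Function.update_self, hτ] at h3
        exact absurd h3.1 (by simp [second_respond])
    have h := hwin 1 (Function.update σ 0 (respond 0 fun _ => false)) fun j hj => by
      obtain rfl : j = 0 := by omega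
      simpa using hB
    rw [winsAgainst_iff] at h
    have := h.2 rfl
    simp [first_respond] at this
  exact ⟨_, muller, hor, hor.agAnd, haa, fun h => haa h.aa⟩

/-- Player 1 can win outright by `x = true`, so admissibility forces this move and everybody wins.
Under AG∧ the others may choose `x = false`, `y = true`; only player 0, who never moves, then loses.
-/
theorem exists_aa_not_agAnd : ∃ G : ArenaGame.{0, 0, 0} (Fin 3),
    G.Muller ∧ G.AA ∧ ¬ G.AGAnd ∧ ¬ G.AGOr ∧ ¬ G.Win := by
  let payoff : Fin 3 → Bool → Bool → Prop := fun i x y =>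
    (i = 0 → x = true ∨ y = false) ∧ (i = 1 → x = true ∨ y = true)
  have hag : ¬ (game 1 2 payoff).AGAnd := by
    refine not_agAnd 0 fun σ => ⟨fun i => if i = 0 then σ i else respond i fun _ => i = 2, rfl,
      fun j hj => ⟨fun h => absurd h hj, fun _ => Or.inr rfl⟩, fun h => ?_⟩
    have := h.1 rfl
    simp [first_respond, second_respond] at this
  have hroot : ∀ τ : (game 1 2 payoff).Strategy 1, first τ = true →
      ∀ σ, (game 1 2 payoff).WinsAgainst τ σ := by
    intro τ hτ σ
    rw [winsAgainst_iff]
    exact ⟨fun h => absurd h (by decide), fun _ => Or.inl (by simpa using hτ)⟩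
  have haa : (game 1 2 payoff).AA := by
    refine ⟨fun i => respond i fun _ => true, fun i => ?_, fun i σ' hσ' => ?_⟩
    · rcases (by omega : i = 0 ∨ i = 1 ∨ i = 2) with rfl | rfl | rfl
      · rintro ⟨τ, -, σ, h1, h2⟩
        rw [winsAgainst_iff] at h1 h2
        exact h2 (by simpa using h1)
      · exact ArenaGame.admissible_of_forall_winsAgainst (hroot _ rfl)
      · exact ArenaGame.admissible_of_forall_winsAgainst fun σ =>
          winsAgainst_iff.2 ⟨fun h => absurd h (by decide), fun h => absurd h (by decide)⟩
    · rcases (by omega : i = 0 ∨ i = 1 ∨ i = 2) with rfl | rfl | rfl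
      · have h1 : first (σ' 1) = true := by
          by_contra hf
          rw [Bool.not_eq_true] at hf
          refine hσ' 1 (by decide) ⟨respond 1 fun _ => true, fun σ _ => hroot _ rfl σ,
            fun i => respond i fun _ => false, hroot _ rfl _, fun h => ?_⟩
          have := (winsAgainst_iff.1 h).2 rfl
          simp [hf, second_respond] at this
        rw [winsAgainst_iff]
        exact ⟨fun _ => Or.inl (by simpa using h1), fun h => absurd h (by decide)⟩
      · exact hroot _ rfl _
      · exact winsAgainst_iff.2 ⟨fun h => absurd h (by decide), fun h => absurd h (by decide)⟩
  exact ⟨_, muller, haa, hag, fun h => hag h.agAnd, fun h => hag h.agOr.agAnd⟩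

/-- Player 0 always wins and alone decides whether player 1 wins. -/
theorem exists_coop_not_agAnd : ∃ G : ArenaGame.{0, 0, 0} (Fin 2),
    G.Muller ∧ G.Coop ∧ ¬ G.AGAnd ∧ ¬ G.AGOr := by
  let payoff : Fin 2 → Bool → Bool → Prop := fun i x _ => i = 1 → x = true
  have hag : ¬ (game 0 1 payoff).AGAnd := by
    refine not_agAnd 1 fun σ => ⟨fun i => if i = 1 then σ i else respond i fun _ => false, rfl,
      fun j hj h => absurd h hj, fun h => ?_⟩
    have := h rfl
    simp [first_respond] at this
  refine ⟨game 0 1 payoff, muller, ?_, hag, fun h => hag h.agAnd⟩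
  exact coop_iff.2 ⟨fun i => respond i fun _ => true, fun _ _ => rfl⟩

/-- Player 1 has no dominant strategy: whatever her first move is, player 2 may reward only the
other one. -/
theorem exists_coop_not_rs_dom : ∃ G : ArenaGame.{0, 0, 0} (Fin 3), G.Muller ∧ G.Coop ∧
    ¬ G.RSExists 0 SolutionConcept.dom ∧ ¬ G.RSForall 0 SolutionConcept.dom := by
  let payoff : Fin 3 → Bool → Bool → Prop := fun _ _ y => y = true
  have hrs : ¬ (game 1 2 payoff).RSExists 0 SolutionConcept.dom := by
    rintro ⟨σ, hst, -⟩
    obtain ⟨x, hx⟩ : ∃ x, first (σ 1) = x := ⟨_, rfl⟩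
    have := hst 1 (by decide) (respond 1 fun _ => !x)
      (Function.update σ 2 (respond 2 fun z => z != x)) (by simp)
      (winsAgainst_iff.2 (by simp [payoff, first_respond, second_respond]))
    rw [winsAgainst_iff] at this
    simp [payoff, hx, second_respond] at this
  refine ⟨game 1 2 payoff, muller, ?_, hrs, fun h => hrs h.rsExists⟩
  exact coop_iff.2 ⟨fun i => respond i fun _ => true, fun _ => rfl⟩

/-- Player 0 owns every state and the objectives are opposed. The environment has a single strategy,
so every profile is stable. -/
theorem exists_rs_not_coop : ∃ G : ArenaGame.{0, 0, 0} (Fin 2), G.Muller ∧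
    (∀ γ, G.RSExists 0 γ ∧ G.RSForall 0 γ) ∧
      ¬ G.Coop ∧ ¬ G.AA ∧ ¬ G.AGAnd ∧ ¬ G.AGOr ∧ ¬ G.Win := by
  let payoff : Fin 2 → Bool → Bool → Prop := fun i x _ => x = decide (i = 0)
  have hcoop : ¬ (game 0 0 payoff).Coop := by
    rw [coop_iff]
    rintro ⟨σ, hσ⟩
    exact absurd ((hσ 0).symm.trans (hσ 1)) (by simp)
  have hsub : ∀ i : Fin 2, i ≠ 0 → Subsingleton ((game 0 0 payoff).Strategy i) := by
    intro i hi
    refine ⟨fun τ τ' => funext fun _ => funext fun n => absurd ?_ hi⟩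
    have hown : ∀ m : Node, owner (0 : Fin 2) 0 m = 0 := fun m => by cases m <;> rfl
    exact (n.2.symm.trans (hown n.1))
  have hstable : ∀ σ γ, (game 0 0 payoff).Stable 0 σ γ := by
    have hnash : ∀ s obj σ, (game 0 0 payoff).NashFrom s obj {i | i ≠ 0} σ := by
      intro s obj σ i hi τ h
      have := hsub i hi
      rwa [Subsingleton.elim τ (σ i), Function.update_eq_self] at h
    intro σ γ
    cases γ with
    | NE => exact hnash _ _ _
    | SPE => exact fun h s _ => hnash _ _ _
    | dom =>
      intro j hj τ σ' _ h
      have := hsub j hj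
      rwa [Subsingleton.elim (σ j) τ]
  have hall : ∀ γ, (game 0 0 payoff).RSForall 0 γ := fun γ =>
    ⟨respond 0 fun _ => true, ⟨fun i => respond i fun _ => true, rfl, hstable _ γ⟩,
      fun σ hσ _ => models_obj_iff.2 (by rw [hσ]; rfl)⟩
  exact ⟨_, muller, fun γ => ⟨(hall γ).rsExists, hall γ⟩, hcoop, fun h => hcoop h.coop,
    fun h => hcoop h.coop, fun h => hcoop h.agAnd.coop, fun h => hcoop h.aa.coop⟩

end TwoMove

theorem mainTheorem5 :
    -- implications, for every game and every choice of the system player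
    (∀ (Agt : Type u) [Finite Agt] [DecidableEq Agt] (G : ArenaGame.{u, v, w} Agt) (sys : Agt),
      (G.Win → G.AA) ∧ (G.Win → G.AGOr) ∧ (G.Win → G.AGAnd) ∧
      (G.Win → ∀ γ, γ ≠ SolutionConcept.SPE → G.RSExists sys γ ∧ G.RSForall sys γ) ∧
      (G.AA → G.Coop) ∧ (G.AGOr → G.AGAnd) ∧ (G.AGOr → G.Coop) ∧ (G.AGAnd → G.Coop) ∧
      (G.Coop → G.RSExists sys SolutionConcept.NE) ∧
      (G.OmegaRegular →
        (G.Win → G.RSExists sys SolutionConcept.SPE ∧ G.RSForall sys SolutionConcept.SPE) ∧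
        (G.Coop → G.RSExists sys SolutionConcept.SPE) ∧
        (Nat.card Agt = 2 → G.AA → G.AGAnd))) ∧
    -- neither AG rule implies AA or Win
    (∃ G : ArenaGame.{0, 0, 0} (Fin 2), G.Muller ∧ G.AGOr ∧ G.AGAnd ∧ ¬ G.AA ∧ ¬ G.Win) ∧
    -- AA implies neither an AG rule nor Win
    (∃ G : ArenaGame.{0, 0, 0} (Fin 3), G.Muller ∧ G.AA ∧ ¬ G.AGAnd ∧ ¬ G.AGOr ∧ ¬ G.Win) ∧
    -- Coop implies neither AA nor Win
    (∃ G : ArenaGame.{0, 0, 0} (Fin 2), G.Muller ∧ G.Coop ∧ ¬ G.AA ∧ ¬ G.Win) ∧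
    -- Coop implies neither AG rule
    (∃ G : ArenaGame.{0, 0, 0} (Fin 2), G.Muller ∧ G.Coop ∧ ¬ G.AGAnd ∧ ¬ G.AGOr) ∧
    -- Coop does not imply all RS rules
    (∃ G : ArenaGame.{0, 0, 0} (Fin 3), G.Muller ∧ G.Coop ∧
      ¬ G.RSExists 0 SolutionConcept.dom ∧ ¬ G.RSForall 0 SolutionConcept.dom) ∧
    -- no RS rule implies any rule of another group
    (∃ G : ArenaGame.{0, 0, 0} (Fin 2), G.Muller ∧
      (∀ γ, G.RSExists 0 γ ∧ G.RSForall 0 γ) ∧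
      ¬ G.Coop ∧ ¬ G.AA ∧ ¬ G.AGAnd ∧ ¬ G.AGOr ∧ ¬ G.Win) := by
  obtain ⟨G, hM, hor, hand, haa, hwin⟩ := TwoMove.exists_ag_not_aa
  refine ⟨?_, ⟨G, hM, hor, hand, haa, hwin⟩, TwoMove.exists_aa_not_agAnd,
    ⟨G, hM, hand.coop, haa, hwin⟩, TwoMove.exists_coop_not_agAnd, TwoMove.exists_coop_not_rs_dom,
    TwoMove.exists_rs_not_coop⟩
  intro Agt _ _ G sys
  exact ⟨fun h => h.aa, fun h => h.agOr, fun h => h.agOr.agAnd,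
    fun h γ hγ => ⟨(h.rsForall sys hγ).rsExists, h.rsForall sys hγ⟩, fun h => h.coop,
    fun h => h.agAnd, fun h => h.agAnd.coop, fun h => h.coop, fun h => h.rsExists_NE sys,
    fun hG => ⟨fun h => ⟨(h.rsForall_SPE hG sys).rsExists, h.rsForall_SPE hG sys⟩,
      fun h => h.rsExists_SPE hG sys, fun hcard h => h.agAnd hG hcard⟩⟩
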